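/- **Setting.** For $n$ data points $x^{(1)},\dots,x^{(n)}\in[0,1]^d$ and a loss $f:[0,1]^d\times\mathbb R^p\to\mathbb R$ put $F(\theta)=\frac1n\sum_{j}f(x^{(j)};\theta)$ and $F_*=\inf_\theta F(\theta)$; $\theta$ is an $\epsilon$-approximate solution if $F(\theta)-F_*\le\epsilon$. Assume, with $\mu,L_1,L_2,\eta>0$ and $l=\lceil\eta\rceil-1$: for each $x\in[0,1]^d$, $\nabla_\theta f(x;\cdot)$ exists and is $L_1$-Lipschitz in $\|\cdot\|_2$, and $f(x;\cdot)$ is $\mu$-strongly convex; for each $\theta$ and $i$, $\frac{\partial f}{\partial\theta_i}(\cdot;\theta)$ is $l$ times differentiable on $[0,1]^d$ and all its partial derivatives $g$ of order $l$ satisfy $|g(y)-g(y')|\le L_2\|y-y'\|_1^{\eta-l}$. Let $K:\mathbb R\to\mathbb R$ take values in $[b,c]$ on $[-1,1]$, where $0<b\le c$, and vanish outside $[-1,1]$. Put $\sigma=L_1/\mu$ and $$\Lambda=\Big(\tfrac{\pi d}{8e^2}\Big)^{dA}(A-1)^{A-1}(l+d)^{-3l\left(\frac{e(l+d)}{d}\right)^{d}},\qquad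 A=\Big(\tfrac{l+d}{d}\Big)^{d}.$$ All data lie in $[h',1-h']^d$ with $h'=\frac{2b}{55(2L_2+1)c}\cdot\frac{\Lambda l}{d}$. **LPI-GD.** Given $\epsilon>0$ and $\theta^{(0)}\in\mathbb R^p$, put $$T=\Big\lceil\Big(\log\tfrac{\sigma}{\sigma-1}\Big)^{-1}\log\frac{F(\theta^{(0)})-F_*+\frac{p}{2\mu}}{\epsilon}\Big\rceil,\quad \delta=\Big(1-\tfrac1\sigma\Big)^{T/2},\quad m=\Big\lceil\tfrac{110(2L_2+1)c}{b}\,\tfrac{d(3e)^d}{\Lambda^2}\,\delta^{-1/\eta}\Big\rceil,\quad h=\frac{4l(3e)^d}{m\Lambda},$$ and let $\mathcal G=\{1/m,2/m,\dots,1\}^d$. With $U(u)=[u^s/s!]_{s\in\mathbb Z_+^d,\,|s|\le l}$, $\kappa_y(x)=(mh)^{-d}\prod_jK\big(\frac{y_j-x_j}{h}\big)$ and $B(x)=\sum_{y\in\mathcal G}\kappa_y(x)\,U\big(\frac{y-x}h\big)U\big(\frac{y-x}h\big)^{\mathrm T}$, let $w_y^*(x)$ be the entry with index $s=0$ of $\kappa_y(x)B(x)^{-1}U\big(\frac{y-x}h\big)$.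 For $t=1,\dots,T$ the algorithm calls the first order oracle $(y,\theta)\mapsto\nabla_\theta f(y;\theta)$ at $(y,\theta^{(t-1)})$ for all $y\in\mathcal G$ (that is, $m^d$ calls) and sets $$\theta^{(t)}=\theta^{(t-1)}-\frac1{L_1n}\sum_{j=1}^n\sum_{y\in\mathcal G}w_y^*(x^{(j)})\,\nabla_\theta f(y;\theta^{(t-1)}).$$ Its oracle complexity $\Gamma(\text{LPI-GD})$ is the minimum number of oracle calls it makes to obtain an $\epsilon$-approximate solution, i.e. the minimum of $t\,m^d$ over all $0\le t\le T$ such that $\theta^{(t)}$ is an $\epsilon$-approximate solution ($\infty$ if there is none). **Proposition.** Fix constants $\alpha>0$, $\beta>0$, $\tau>\max\{1,\alpha^{-1}\}$ and $\gamma>\max\{1,\tau(\alpha+\beta)/2\}$. For every $n$ let a problem with $n$ data points as above be given, all of whose parameters may depend on $n$, such that, as $n\to\infty$: $\epsilon=\Theta(n^{-\alpha})$, $p=O(n^\beta)$, $\eta=\Theta(d)$; for all sufficiently large $n$, $\epsilon>0$, $19\le d\le\frac{\log\log n}{4\log(e(\gamma+1))}$, $\eta\ge\tau(\alpha+\beta)d/2$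 and $d\le l=\lceil\eta\rceil-1\le\gamma d$; the quantities $\mu,L_1,L_2,b,c$ and $F(\theta^{(0)})-F_*$ are $\Theta(1)$; and $\sigma=L_1/\mu\ge\sigma_0$ for all large $n$, for some constant $\sigma_0>1$. Then $\Gamma(\text{LPI-GD})$ is finite for all large $n$ and $$\Gamma(\text{LPI-GD})=O\!\left(\log(n)\exp\!\big(2\sqrt{\log n}\big)\,n^{1/\tau}\right).$$ Moreover, for all functions $\Gamma_*(\text{GD})=\Theta(n\log(1/\epsilon))$ and $\Gamma_*(\text{SGD})=\Theta(1/\epsilon)$ of $n$ (the forms of the known oracle complexity bounds of gradient descent and stochastic gradient descent), $$\lim_{n\to\infty}\frac{\Gamma(\text{LPI-GD})}{\Gamma_*(\text{GD})}=\lim_{n\to\infty}\frac{\Gamma(\text{LPI-GD})}{\Gamma_*(\text{SGD})}=0 .$$ -/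

import Mathlib

open Filter Topology Asymptotics

noncomputable section

namespace LPIGD

/-- The parameter space `ℝ^p` with its Euclidean norm. -/
abbrev Param (p : ℕ) : Type := EuclideanSpace ℝ (Fin p)

/-- The data domain `[0,1]^d`. -/
def cube (d : ℕ) : Set (Fin d → ℝ) := Set.Icc 0 1

/-- The order `l = ⌈η⌉ - 1` attached to a Hölder exponent `η > 0`. -/
def holderOrder (η : ℝ) : ℕ := ⌈η⌉₊ - 1

/-- The `(η, L)`-Hölder class on `[0,1]^d`: `g` is `l = ⌈η⌉ - 1` times differentiable on the closed
cube, and every partial derivative of order `l` (differentiation along the coordinates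
`i 0, …, i (l-1)`) is Hölder continuous with exponent `η - l` and constant `L` for the
`ℓ¹`-distance. -/
def HolderClass {d : ℕ} (η L : ℝ) (g : (Fin d → ℝ) → ℝ) : Prop :=
  (∀ k < holderOrder η, DifferentiableOn ℝ (iteratedFDerivWithin ℝ k g (cube d)) (cube d)) ∧
  ∀ i : Fin (holderOrder η) → Fin d, ∀ y₁ ∈ cube d, ∀ y₂ ∈ cube d,
    |iteratedFDerivWithin ℝ (holderOrder η) g (cube d) y₁ (fun k => Pi.single (i k) 1)
      - iteratedFDerivWithin ℝ (holderOrder η) g (cube d) y₂ (fun k => Pi.single (i k) 1)|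
      ≤ L * (∑ j, |y₁ j - y₂ j|) ^ (η - holderOrder η)

/-- The constant `Λ(d,l)`. -/
def Lam (d l : ℕ) : ℝ :=
  (Real.pi * d / (8 * Real.exp 1 ^ 2)) ^ ((d : ℝ) * (((l : ℝ) + d) / d) ^ d)
    * ((((l : ℝ) + d) / d) ^ d - 1) ^ ((((l : ℝ) + d) / d) ^ d - 1)
    * (1 / ((l : ℝ) + d) ^ (3 * (l : ℝ) * (Real.exp 1 * ((l : ℝ) + d) / d) ^ d))

/-! ### Local polynomial interpolation -/

/-- Multi-indices `s ∈ ℤ₊^d` with `|s| ≤ l` (each entry is then automatically at most `l`). -/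
abbrev MultiIdx (d l : ℕ) : Type := {s : Fin d → Fin (l + 1) // ∑ i, (s i : ℕ) ≤ l}

/-- The multi-index `0`, which is the first one in lexicographical order. -/
def MultiIdx.zero (d l : ℕ) : MultiIdx d l := ⟨fun _ => 0, by simp⟩

/-- The vector `U(u) = [u^s / s! : |s| ≤ l]`. -/
def polyVec {d : ℕ} (l : ℕ) (u : Fin d → ℝ) : MultiIdx d l → ℝ := fun s =>
  (∏ i, u i ^ (s.1 i : ℕ)) / ∏ i, (Nat.factorial (s.1 i) : ℝ)

/-- The points of the uniform grid `{u ∈ [0,1]^d : m u_i ∈ {1,…,m} for all i}`,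
indexed by `Fin d → Fin m`. -/
def gridPoint {d : ℕ} (m : ℕ) (k : Fin d → Fin m) : Fin d → ℝ := fun i => (((k i : ℕ) : ℝ) + 1) / m

/-- The rescaled vector `(y - x) / h` for the grid point `y` with index `k`. -/
def scaled {d : ℕ} (m : ℕ) (h : ℝ) (x : Fin d → ℝ) (k : Fin d → Fin m) : Fin d → ℝ :=
  fun j => (gridPoint m k j - x j) / h

/-- The matrix `B(x) = (mh)^{-d} ∑_y U((y-x)/h) U((y-x)/h)ᵀ ∏_j K((y_j - x_j)/h)`. -/
def gramMatrix {d : ℕ} (K : ℝ → ℝ) (l m : ℕ) (h : ℝ) (x : Fin d → ℝ) :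
    Matrix (MultiIdx d l) (MultiIdx d l) ℝ := fun r s =>
  1 / ((m : ℝ) * h) ^ d * ∑ k : Fin d → Fin m,
    polyVec l (scaled m h x k) r * polyVec l (scaled m h x k) s * ∏ j, K (scaled m h x k j)

/-- The interpolation weight `w*_y(x)` of the grid point `y` with index `k`: the first entry of
`(mh)^{-d} (∏_j K((y_j - x_j)/h)) B(x)⁻¹ U((y-x)/h)`. -/
def interpWeight {d : ℕ} (K : ℝ → ℝ) (l m : ℕ) (h : ℝ) (x : Fin d → ℝ) (k : Fin d → Fin m) : ℝ :=
  1 / ((m : ℝ) * h) ^ d * (∏ j, K (scaled m h x k j))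
    * ((gramMatrix K l m h x)⁻¹).mulVec (polyVec l (scaled m h x k)) (MultiIdx.zero d l)

/-! ### The empirical risk minimization problem -/

/-- The data of an empirical risk minimization problem with `n` samples of dimension `d` and
`p` parameters, together with the inputs of the LPI-GD algorithm
(the laws are in `Setup.Assumptions`). -/
structure Setup (n d p : ℕ) where
  /-- the loss function `f(x;θ)`; only its values for `x ∈ [0,1]^d` matter -/
  loss : (Fin d → ℝ) → Param p → ℝ
  /-- the training data -/
  data : Fin n → Fin d → ℝ
  /-- strong convexity parameter -/
  μ : ℝ
  /-- Lipschitz constant of the gradient -/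
  L₁ : ℝ
  /-- Hölder constant -/
  L₂ : ℝ
  /-- Hölder exponent -/
  η : ℝ
  /-- lower bound on the kernel -/
  b : ℝ
  /-- upper bound on the kernel -/
  c : ℝ
  /-- the kernel, extended by zero outside `[-1,1]` -/
  kernel : ℝ → ℝ
  /-- the initial parameter vector -/
  θ₀ : Param p

namespace Setup

variable {n d p : ℕ} (S : Setup n d p)

/-- The first order oracle `O(x,θ) = ∇_θ f(x;θ)`. -/
def oracle (x : Fin d → ℝ) (θ : Param p) : Param p := gradient (S.loss x) θ

/-- The objective function `F(θ) = (1/n) ∑_j f(x^{(j)};θ)`. -/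
def F (θ : Param p) : ℝ := 1 / (n : ℝ) * ∑ j, S.loss (S.data j) θ

/-- The infimum `F_*` of the objective function. -/
def Fstar : ℝ := ⨅ θ, S.F θ

/-- `θ` is an `ε`-approximate solution: `F(θ) - F_* ≤ ε`. -/
def IsApproxSol (ε : ℝ) (θ : Param p) : Prop := S.F θ - S.Fstar ≤ ε

/-- The order `l = ⌈η⌉ - 1`. -/
def l : ℕ := holderOrder S.η

/-- The margin `h'`: the training data has to lie in `[h', 1 - h']^d`. -/
def margin : ℝ := 2 * S.b / (55 * (2 * S.L₂ + 1) * S.c) * (Lam d S.l * S.l / d)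

/-- The standing assumptions on the loss function, the kernel and the training data. -/
structure Assumptions : Prop where
  μ_pos : 0 < S.μ
  L₁_pos : 0 < S.L₁
  L₂_pos : 0 < S.L₂
  η_pos : 0 < S.η
  b_pos : 0 < S.b
  b_le_c : S.b ≤ S.c
  /-- the gradient in the parameter exists -/
  differentiable : ∀ x ∈ cube d, Differentiable ℝ (S.loss x)
  /-- the gradient in the parameter is `L₁`-Lipschitz -/
  lipschitz : ∀ x ∈ cube d, ∀ θ₁ θ₂ : Param p,
    ‖gradient (S.loss x) θ₁ - gradient (S.loss x) θ₂‖ ≤ S.L₁ * ‖θ₁ - θ₂‖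
  /-- the partial derivatives in the parameter are `(η, L₂)`-Hölder in the data -/
  holder : ∀ (θ : Param p) (i : Fin p), HolderClass S.η S.L₂ (fun x => gradient (S.loss x) θ i)
  /-- strong convexity in the parameter -/
  strong_convex : ∀ x ∈ cube d, ∀ θ₁ θ₂ : Param p,
    S.loss x θ₂ + inner ℝ (gradient (S.loss x) θ₂) (θ₁ - θ₂) + S.μ / 2 * ‖θ₁ - θ₂‖ ^ 2
      ≤ S.loss x θ₁
  kernel_mem : ∀ u ∈ Set.Icc (-1 : ℝ) 1, S.kernel u ∈ Set.Icc S.b S.c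
  kernel_zero : ∀ u ∉ Set.Icc (-1 : ℝ) 1, S.kernel u = 0
  data_mem : ∀ j i, S.data j i ∈ Set.Icc S.margin (1 - S.margin)

/-! ### The LPI-GD algorithm -/

/-- The condition number `σ = L₁ / μ`. -/
def σ : ℝ := S.L₁ / S.μ

/-- The number of iterations `T`. -/
def T (ε : ℝ) : ℕ :=
  ⌈(Real.log (S.σ / (S.σ - 1)))⁻¹ * Real.log ((S.F S.θ₀ - S.Fstar + p / (2 * S.μ)) / ε)⌉₊

/-- The allowed approximation error `δ = (1 - 1/σ)^{T/2}`. -/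
def δ (ε : ℝ) : ℝ := (1 - 1 / S.σ) ^ ((S.T ε : ℝ) / 2)

/-- The grid size parameter `m`. -/
def m (ε : ℝ) : ℕ :=
  ⌈110 * (2 * S.L₂ + 1) * S.c / S.b * (d * (3 * Real.exp 1) ^ d / Lam d S.l ^ 2)
    * (1 / S.δ ε) ^ (1 / S.η)⌉₊

/-- The bandwidth `h = 4 l (3e)^d / (m Λ(d,l))`. -/
def h (ε : ℝ) : ℝ := 4 * S.l * (3 * Real.exp 1) ^ d / (S.m ε * Lam d S.l)

/-- The estimate of `∇F` computed from the answers of the oracle at the grid points: the average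
over the data of the local polynomial interpolators. -/
def gradEstimate (ε : ℝ) (answer : (Fin d → Fin (S.m ε)) → Param p) : Param p :=
  (1 / (n : ℝ)) • ∑ j, ∑ k, interpWeight S.kernel S.l (S.m ε) (S.h ε) (S.data j) k • answer k

/-- The state of the LPI-GD algorithm after `t` iterations: the parameter vector `θ^{(t)}` and the
number of oracle calls made so far. An iteration calls the oracle once at each of the grid points
and uses only the answers. -/
def run (ε : ℝ) : ℕ → Param p × ℕ
  | 0 => (S.θ₀, 0)
  | t + 1 =>
    ((run ε t).1 - (1 / S.L₁) • S.gradEstimate ε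
        (fun k => S.oracle (gridPoint (S.m ε) k) (run ε t).1),
      (run ε t).2 + Fintype.card (Fin d → Fin (S.m ε)))

/-- The first order oracle complexity `Γ(LPI-GD)`: the minimum number of oracle calls which the
algorithm (it performs `T` iterations) makes to obtain an `ε`-approximate solution;
it is `⊤` if none of its iterates is an `ε`-approximate solution. -/
def Gam (ε : ℝ) : ℕ∞ :=
  ⨅ (t : ℕ) (_ : t ≤ S.T ε) (_ : S.IsApproxSol ε (S.run ε t).1), ((S.run ε t).2 : ℕ∞)

end Setup

end LPIGD

end

/-! The oracle is called on a grid of `m^d` points, whatever the number of data points; smoothness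
in the data variable turns the answers into an estimate of the gradient at every data point. The
proof has three ingredients.

Interpolation. The weights reproduce polynomials of degree at most `l`, so the error at a data point
is at most the Lebesgue constant (the sum of the absolute weights) times the Taylor error `L₂ (d
h)^η`. No eigenvalue bound for the matrix `B` is needed: with `v = B⁻¹ e₀`, each weight is the
kernel factor times the value of the polynomial with coefficients `v`, and Cauchy–Schwarz reduces
the Lebesgue constant to the single number `v₀`. This number is controlled by recovering the value
at `0` of a polynomial from `(l+1)^d` grid points near `x` by tensor product Lagrange interpolation.
Since `Λ` is tiny, the resulting bound is absorbed by the choice of `h`, and each partial derivative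
is estimated up to `δ` (`abs_sum_interpWeight_sub_le`).

Optimization. The descent lemma and the Polyak–Łojasiewicz inequality show that a step with the
estimated gradient contracts the gap by `1 - 1/σ` up to an additive `p δ²/(2 L₁)`; these errors sum
to at most `p δ²/(2 μ)`. As `δ² = (1 - 1/σ)^T`, the definition of `T` makes the final gap at most
`ε`, whence `Γ ≤ T m^d` (`Gam_le`).

Growth. `T` is `O(log n)`. Up to constants, `m^d` is a factor depending on `d` times `δ^(-d/η)`. The
latter is `O(n^(1/τ))`, because `1/δ = O(n^((α+β)/2))` and `η ≥ τ(α+β)d/2`. The former has logarithm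
`O(d³ (e(γ+1))^d)`, which the doubly logarithmic bound on `d` pushes below `√(log n)` plus a
constant. What multiplies `n^(1/τ)` is thus subpolynomial, and `1/τ < min(1, α)` gives both limits.
-/

noncomputable section

namespace LPIGD

/-! ### Tensor product Lagrange interpolation -/

/-- The coefficient of degree `r` of the `j`-th Lagrange basis polynomial of the nodes `t`. -/
def dualCoeff {l : ℕ} (t : Fin (l + 1) → ℝ) (r : ℕ) (j : Fin (l + 1)) : ℝ :=
  (Lagrange.basis Finset.univ t j).coeff r

/-- A monomial of degree at most `l` is its own interpolant at `l + 1` nodes; compare coefficients.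
-/
lemma sum_dualCoeff_mul_pow {l : ℕ} {t : Fin (l + 1) → ℝ} (ht : Function.Injective t)
    (r : ℕ) {s : ℕ} (hs : s ≤ l) :
    ∑ j, dualCoeff t r j * t j ^ s = if r = s then 1 else 0 := by
  have h := Lagrange.eq_interpolate_of_eval_eq (s := Finset.univ) (v := t)
    (f := (Polynomial.X ^ s : Polynomial ℝ)) (fun j => t j ^ s) ht.injOn
    (by
      rw [Polynomial.degree_X_pow, Finset.card_univ, Fintype.card_fin]
      exact_mod_cast Nat.lt_succ_of_le hs)
    (by simp)
  have h' := congrArg (fun P => Polynomial.coeff P r) h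
  simp only [Lagrange.interpolate_apply, Polynomial.finsetSum_coeff, Polynomial.coeff_C_mul,
    Polynomial.coeff_X_pow] at h'
  rw [h']
  exact Finset.sum_congr rfl fun j _ => mul_comm _ _

/-- The value at `0` of the basis polynomial is a product of `l` ratios `-t i / (t j - t i)`, each
at most `(l+1)ρ/ρ` in size. -/
lemma abs_dualCoeff_zero_le {l : ℕ} {t : Fin (l + 1) → ℝ} {ρ : ℝ} (hρ : 0 < ρ)
    (ht : ∀ i, |t i| ≤ (l + 1) * ρ) (hsep : ∀ i j, i ≠ j → ρ ≤ |t i - t j|) (j : Fin (l + 1)) :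
    |dualCoeff t 0 j| ≤ ((l : ℝ) + 1) ^ l := by
  have h1 : dualCoeff t 0 j = ∏ i ∈ Finset.univ.erase j, ((t j - t i)⁻¹ * (0 - t i)) := by
    rw [dualCoeff, Polynomial.coeff_zero_eq_eval_zero, Lagrange.basis, Polynomial.eval_prod]
    refine Finset.prod_congr rfl fun i _ => ?_
    simp [Lagrange.basisDivisor]
  have h2 : ∀ i ∈ Finset.univ.erase j, |(t j - t i)⁻¹ * (0 - t i)| ≤ (l : ℝ) + 1 := by
    intro i hi
    have hne : j ≠ i := (Finset.ne_of_mem_erase hi).symm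
    have hs := hsep j i hne
    rw [abs_mul, abs_inv, zero_sub, abs_neg, inv_mul_le_iff₀ (hρ.trans_le hs)]
    calc |t i| ≤ (l + 1) * ρ := ht i
      _ ≤ |t j - t i| * (l + 1) := by
        rw [mul_comm]; gcongr
  rw [h1, Finset.abs_prod]
  calc _ ≤ ∏ _i ∈ Finset.univ.erase j, ((l : ℝ) + 1) :=
        Finset.prod_le_prod (fun _ _ => abs_nonneg _) h2
    _ = _ := by simp [Finset.card_erase_of_mem]

/-- The polynomial with coefficient vector `q` in the basis `u^s / s!`. -/
def polyEval {d l : ℕ} (q : MultiIdx d l → ℝ) (u : Fin d → ℝ) : ℝ := ∑ s, q s * polyVec l u s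

/-- Products of the one-dimensional coefficient functionals are dual to the monomials, so values on
a tensor grid determine every coefficient. The factorials come from the normalization `u^s / s!`. -/
lemma sum_prod_dualCoeff_mul_polyEval {d l : ℕ} {t : Fin d → Fin (l + 1) → ℝ}
    (ht : ∀ i, Function.Injective (t i)) (q : MultiIdx d l → ℝ) (r : MultiIdx d l) :
    ∑ J : Fin d → Fin (l + 1), (∏ i, dualCoeff (t i) (r.1 i) (J i))
        * polyEval q (fun i => t i (J i))
      = q r / ∏ i, (Nat.factorial (r.1 i) : ℝ) := by
  have key : ∀ s : MultiIdx d l,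
      ∑ J : Fin d → Fin (l + 1), (∏ i, dualCoeff (t i) (r.1 i) (J i)) * ∏ i, t i (J i) ^ (s.1 i : ℕ)
        = if s = r then 1 else 0 := by
    intro s
    simp_rw [← Finset.prod_mul_distrib]
    rw [← Fintype.piFinset_univ, ← Finset.prod_univ_sum (fun _ => Finset.univ)
      (fun i j => dualCoeff (t i) (r.1 i) j * t i j ^ (s.1 i : ℕ))]
    simp_rw [sum_dualCoeff_mul_pow (ht _) _ (Nat.lt_succ_iff.mp (s.1 _).2)]
    split_ifs with h
    · subst h; simp
    · have : ∃ i, s.1 i ≠ r.1 i := by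
        by_contra hc
        push Not at hc
        exact h (Subtype.ext (funext hc))
      obtain ⟨i, hi⟩ := this
      refine Finset.prod_eq_zero (Finset.mem_univ i) (if_neg fun h' => hi (Fin.ext h'.symm))
  unfold polyEval
  simp_rw [Finset.mul_sum]
  rw [Finset.sum_comm]
  have : ∀ s : MultiIdx d l, ∑ J : Fin d → Fin (l + 1),
      (∏ i, dualCoeff (t i) (r.1 i) (J i)) * (q s * polyVec l (fun i => t i (J i)) s)
      = if s = r then q s / ∏ i, (Nat.factorial (s.1 i) : ℝ) else 0 := by
    intro s
    have := congrArg (fun z => q s / (∏ i, (Nat.factorial (s.1 i) : ℝ)) * z) (key s)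
    simp only [mul_ite, mul_one, mul_zero] at this
    rw [← this, Finset.mul_sum]
    refine Finset.sum_congr rfl fun J _ => ?_
    simp only [polyVec]
    ring
  simp_rw [this]
  simp

lemma polyEval_zero {d l : ℕ} (q : MultiIdx d l → ℝ) :
    polyEval q 0 = q (MultiIdx.zero d l) := by
  unfold polyEval
  rw [Finset.sum_eq_single (MultiIdx.zero d l)]
  · simp [polyVec, MultiIdx.zero]
  · intro s _ hs
    have : ∃ i, s.1 i ≠ 0 := by
      by_contra hc
      push Not at hc
      exact hs (Subtype.ext (funext hc))
    obtain ⟨i, hi⟩ := this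
    have hz : ∏ i, (0 : Fin d → ℝ) i ^ (s.1 i : ℕ) = 0 :=
      Finset.prod_eq_zero (Finset.mem_univ i) (by
        simp only [Pi.zero_apply]
        exact zero_pow fun h => hi (Fin.ext h))
    rw [polyVec, hz, zero_div, mul_zero]
  · simp

/-- Cauchy–Schwarz in the formula for the constant coefficient: there are `(l+1)^d` nodes, and each
squared functional weight is at most `(l+1)^(2ld)`. -/
lemma sq_coeff_zero_le {d l : ℕ} {t : Fin d → Fin (l + 1) → ℝ} {ρ : ℝ} (hρ : 0 < ρ)
    (ht : ∀ i j, |t i j| ≤ (l + 1) * ρ) (hsep : ∀ i j j', j ≠ j' → ρ ≤ |t i j - t i j'|)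
    (q : MultiIdx d l → ℝ) :
    q (MultiIdx.zero d l) ^ 2 ≤ ((l : ℝ) + 1) ^ ((2 * l + 1) * d)
      * ∑ J : Fin d → Fin (l + 1), polyEval q (fun i => t i (J i)) ^ 2 := by
  have hinj : ∀ i, Function.Injective (t i) := by
    intro i j j' hjj
    by_contra hne
    have := hsep i j j' hne
    rw [hjj, sub_self, abs_zero] at this
    linarith
  have h0 := sum_prod_dualCoeff_mul_polyEval hinj q (MultiIdx.zero d l)
  simp only [MultiIdx.zero, Fin.val_zero, Nat.factorial_zero, Nat.cast_one, Finset.prod_const_one,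
    div_one] at h0
  rw [show q (MultiIdx.zero d l) = _ from h0.symm]
  refine (Finset.sum_mul_sq_le_sq_mul_sq _ _ _).trans ?_
  refine mul_le_mul_of_nonneg_right ?_ (Finset.sum_nonneg fun _ _ => sq_nonneg _)
  calc ∑ J : Fin d → Fin (l + 1), (∏ i, dualCoeff (t i) 0 (J i)) ^ 2
      ≤ ∑ _J : Fin d → Fin (l + 1), (((l : ℝ) + 1) ^ (l * d)) ^ 2 := by
        refine Finset.sum_le_sum fun J _ => ?_
        rw [← sq_abs, Finset.abs_prod]
        refine pow_le_pow_left₀ (Finset.prod_nonneg fun _ _ => abs_nonneg _) ?_ 2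
        calc _ ≤ ∏ _i : Fin d, ((l : ℝ) + 1) ^ l :=
              Finset.prod_le_prod (fun _ _ => abs_nonneg _)
                fun i _ => abs_dualCoeff_zero_le hρ (ht i) (hsep i) (J i)
          _ = _ := by rw [Finset.prod_const, Finset.card_univ, Fintype.card_fin, pow_mul]
    _ = ((l : ℝ) + 1) ^ ((2 * l + 1) * d) := by
        rw [Finset.sum_const, Finset.card_univ, Fintype.card_fun, Fintype.card_fin,
          Fintype.card_fin, nsmul_eq_mul]
        push_cast
        rw [← pow_mul, ← pow_add]
        congr 1
        ring

/-! ### Interpolation nodes on the grid -/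

/-- The `l + 1` consecutive indices starting at `⌊m x⌋` work. Index `k` stands for the grid point
`(k+1)/m`, and the distance of `x` from the right end leaves room for all of them. -/
lemma exists_nodes {m l : ℕ} {h x : ℝ} (hM : (l : ℝ) + 1 ≤ m * h)
    (hx : x ∈ Set.Icc h (1 - h)) :
    ∃ k : Fin (l + 1) → Fin m, Function.Injective k ∧
      ∀ j, |((k j : ℕ) : ℝ) + 1 - m * x| ≤ l + 1 := by
  have hl : (0 : ℝ) ≤ l := l.cast_nonneg
  have hm : (0 : ℝ) ≤ m := m.cast_nonneg
  have hmx : (m : ℝ) * h ≤ m * x := mul_le_mul_of_nonneg_left hx.1 hm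
  have hmx' : (m : ℝ) * x ≤ m * (1 - h) := mul_le_mul_of_nonneg_left hx.2 hm
  have hf := Nat.floor_le (show (0 : ℝ) ≤ m * x by linarith)
  have hf' := Nat.lt_floor_add_one ((m : ℝ) * x)
  have hlt : ∀ j : Fin (l + 1), ⌊(m : ℝ) * x⌋₊ + (j : ℕ) < m := by
    intro j
    have hj : ((j : ℕ) : ℝ) ≤ l := by exact_mod_cast Nat.lt_succ_iff.mp j.2
    have : ((⌊(m : ℝ) * x⌋₊ + (j : ℕ) : ℕ) : ℝ) < m := by
      push_cast
      linarith
    exact_mod_cast this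
  refine ⟨fun j => ⟨⌊(m : ℝ) * x⌋₊ + j, hlt j⟩, ?_, ?_⟩
  · intro j j' hjj
    simp only [Fin.mk.injEq, add_right_inj] at hjj
    exact Fin.ext hjj
  · intro j
    have hj : ((j : ℕ) : ℝ) ≤ l := by exact_mod_cast Nat.lt_succ_iff.mp j.2
    have hj0 : (0 : ℝ) ≤ ((j : ℕ) : ℝ) := Nat.cast_nonneg _
    push_cast
    rw [abs_le]
    constructor <;> linarith

lemma scaled_apply {d m : ℕ} (hm : 0 < m) (h : ℝ) (x : Fin d → ℝ) (k : Fin d → Fin m) (i : Fin d) :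
    scaled m h x k i = (((k i : ℕ) : ℝ) + 1 - m * x i) / (m * h) := by
  have : (m : ℝ) ≠ 0 := by positivity
  unfold scaled gridPoint
  field_simp

/-- A kernel with values in `[b,c]` on `[-1,1]` which vanishes elsewhere. -/
structure IsBoxKernel (K : ℝ → ℝ) (b c : ℝ) : Prop where
  pos : 0 < b
  mem : ∀ u ∈ Set.Icc (-1 : ℝ) 1, K u ∈ Set.Icc b c
  zero : ∀ u ∉ Set.Icc (-1 : ℝ) 1, K u = 0

lemma IsBoxKernel.nonneg {K : ℝ → ℝ} {b c : ℝ} (hK : IsBoxKernel K b c) (u : ℝ) : 0 ≤ K u := by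
  by_cases hu : u ∈ Set.Icc (-1 : ℝ) 1
  · exact hK.pos.le.trans (hK.mem u hu).1
  · exact (hK.zero u hu).ge

lemma gramMatrix_mulVec {d : ℕ} (K : ℝ → ℝ) (l m : ℕ) (h : ℝ) (x : Fin d → ℝ)
    (q : MultiIdx d l → ℝ) :
    (gramMatrix K l m h x).mulVec q = ∑ k : Fin d → Fin m,
      (1 / ((m : ℝ) * h) ^ d * (∏ j, K (scaled m h x k j)) * polyEval q (scaled m h x k))
        • polyVec l (scaled m h x k) := by
  funext r
  simp only [Matrix.mulVec, dotProduct, gramMatrix, polyEval, Finset.sum_apply, Pi.smul_apply,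
    smul_eq_mul, Finset.mul_sum, Finset.sum_mul]
  rw [Finset.sum_comm]
  exact Finset.sum_congr rfl fun k _ => Finset.sum_congr rfl fun s _ => by ring

/-- The quadratic form of the Gram matrix. -/
lemma dotProduct_gramMatrix_mulVec {d : ℕ} (K : ℝ → ℝ) (l m : ℕ) (h : ℝ) (x : Fin d → ℝ)
    (q q' : MultiIdx d l → ℝ) :
    q ⬝ᵥ (gramMatrix K l m h x).mulVec q' = 1 / ((m : ℝ) * h) ^ d * ∑ k : Fin d → Fin m,
      (∏ j, K (scaled m h x k j)) * (polyEval q (scaled m h x k) * polyEval q' (scaled m h x k)) := by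
  rw [gramMatrix_mulVec, dotProduct_sum, Finset.mul_sum]
  refine Finset.sum_congr rfl fun k _ => ?_
  rw [dotProduct_smul, smul_eq_mul]
  change _ * polyEval q _ = _
  ring

/-! ### The interpolation weights: existence, polynomial reproduction, Lebesgue constant -/

section weights

variable {d l m : ℕ} {K : ℝ → ℝ} {b c h : ℝ} {x : Fin d → ℝ}

/-- Grid nodes near `x` at which polynomials of degree at most `l` are determined. -/
lemma exists_grid_nodes (hK : IsBoxKernel K b c) (hM : (l : ℝ) + 1 ≤ m * h)
    (hx : ∀ i, x i ∈ Set.Icc h (1 - h)) (q : MultiIdx d l → ℝ) :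
    ((∀ k : Fin d → Fin m, (∏ j, K (scaled m h x k j)) * polyEval q (scaled m h x k) ^ 2 = 0) →
        q = 0) ∧
      q (MultiIdx.zero d l) ^ 2 ≤ ((l : ℝ) + 1) ^ ((2 * l + 1) * d) * (m * h / b) ^ d
        * (q ⬝ᵥ (gramMatrix K l m h x).mulVec q) := by
  have hl : (0 : ℝ) ≤ l := l.cast_nonneg
  have hm : 0 < m := by
    rcases Nat.eq_zero_or_pos m with h0 | h0
    · subst h0; simp at hM; linarith
    · exact h0
  have hMpos : 0 < (m : ℝ) * h := by linarith
  choose k hkinj hk using fun i => exists_nodes hM (hx i)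
  -- In rescaled coordinates the grid spacing is `1/(m h)`, which plays the role of `ρ`; `hM` keeps
  -- these nodes inside the support of the kernel.
  set t : Fin d → Fin (l + 1) → ℝ := fun i j => (((k i j : ℕ) : ℝ) + 1 - m * x i) / (m * h) with htdef
  have hsc : ∀ J : Fin d → Fin (l + 1), scaled m h x (fun i => k i (J i)) = fun i => t i (J i) := by
    intro J; funext i; rw [scaled_apply hm]
  have ht : ∀ i j, |t i j| ≤ (l + 1) * (1 / (m * h)) := by
    intro i j
    rw [htdef, abs_div, abs_of_pos hMpos, mul_one_div]
    exact div_le_div_of_nonneg_right (hk i j) hMpos.le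
  have hsep : ∀ i j j', j ≠ j' → 1 / (m * h) ≤ |t i j - t i j'| := by
    intro i j j' hne
    have hne' : ((k i j : ℕ) : ℤ) - ((k i j' : ℕ) : ℤ) ≠ 0 := by
      intro h0
      exact hne (hkinj i (Fin.ext (by exact_mod_cast sub_eq_zero.mp h0)))
    have h1 : (1 : ℝ) ≤ |((k i j : ℕ) : ℝ) - ((k i j' : ℕ) : ℝ)| := by
      exact_mod_cast Int.one_le_abs hne'
    rw [htdef, ← sub_div, abs_div, abs_of_pos hMpos]
    refine div_le_div_of_nonneg_right (h1.trans_eq ?_) hMpos.le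
    congr 1; ring
  have hinj : ∀ i, Function.Injective (t i) := by
    intro i j j' hjj
    by_contra hne
    have := hsep i j j' hne
    rw [hjj, sub_self, abs_zero] at this
    have : 0 < 1 / ((m : ℝ) * h) := by positivity
    linarith
  have htmem : ∀ i j, t i j ∈ Set.Icc (-1 : ℝ) 1 := by
    intro i j
    rw [Set.mem_Icc, ← abs_le]
    refine (ht i j).trans ?_
    rw [mul_one_div]
    exact (div_le_one hMpos).2 hM
  have hKJ : ∀ J : Fin d → Fin (l + 1), b ^ d ≤ ∏ i, K (t i (J i)) := by
    intro J
    calc b ^ d = ∏ _i : Fin d, b := by simp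
      _ ≤ _ := Finset.prod_le_prod (fun _ _ => hK.pos.le) fun i _ => (hK.mem _ (htmem i (J i))).1
  constructor
  · intro hq
    have hP : ∀ J : Fin d → Fin (l + 1), polyEval q (fun i => t i (J i)) = 0 := by
      intro J
      have := hq (fun i => k i (J i))
      rw [hsc J, mul_eq_zero] at this
      rcases this with h0 | h0
      · have := hKJ J
        have hb : 0 < b ^ d := pow_pos hK.pos d
        linarith
      · exact pow_eq_zero_iff two_ne_zero |>.1 h0
    funext r
    have := sum_prod_dualCoeff_mul_polyEval hinj q r
    simp only [hP, mul_zero, Finset.sum_const_zero] at this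
    have hf : (∏ i, (Nat.factorial (r.1 i) : ℝ)) ≠ 0 :=
      Finset.prod_ne_zero_iff.2 fun i _ => by exact_mod_cast Nat.factorial_ne_zero _
    rcases div_eq_zero_iff.1 this.symm with h0 | h0
    · exact h0
    · exact absurd h0 hf
  · refine (sq_coeff_zero_le (by positivity) ht hsep q).trans ?_
    rw [mul_assoc]
    refine mul_le_mul_of_nonneg_left ?_ (by positivity)
    rw [dotProduct_gramMatrix_mulVec, ← mul_assoc, div_pow, div_mul_div_comm, mul_one, mul_comm (b ^ d),
      div_mul_eq_div_div, div_self (by positivity), one_div, inv_mul_eq_div,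
      le_div_iff₀ (pow_pos hK.pos d), Finset.sum_mul]
    have hinjJ : Function.Injective
        (fun (J : Fin d → Fin (l + 1)) i => k i (J i)) := by
      intro J J' hJ
      funext i
      exact hkinj i (congrFun hJ i)
    -- The nodes are distinct grid points with kernel product at least `b^d`; all other terms of the
    -- quadratic form are nonnegative and can be dropped.
    calc ∑ J : Fin d → Fin (l + 1), polyEval q (fun i => t i (J i)) ^ 2 * b ^ d
        ≤ ∑ J : Fin d → Fin (l + 1), (fun k' => (∏ j, K (scaled m h x k' j))
            * (polyEval q (scaled m h x k') * polyEval q (scaled m h x k'))) (fun i => k i (J i)) := by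
          refine Finset.sum_le_sum fun J _ => ?_
          simp only [hsc J]
          rw [← sq, mul_comm]
          exact mul_le_mul_of_nonneg_right (hKJ J) (sq_nonneg _)
      _ = ∑ k' ∈ Finset.univ.map ⟨_, hinjJ⟩, (∏ j, K (scaled m h x k' j))
            * (polyEval q (scaled m h x k') * polyEval q (scaled m h x k')) := by
          rw [Finset.sum_map]; rfl
      _ ≤ _ := by
          refine Finset.sum_le_sum_of_subset_of_nonneg (Finset.subset_univ _) fun k' _ _ => ?_
          exact mul_nonneg (Finset.prod_nonneg fun _ _ => hK.nonneg _) (mul_self_nonneg _)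

/-- For a null vector the quadratic form is a vanishing sum of nonnegative terms, so the polynomial
vanishes at the nodes and hence is zero. -/
lemma isUnit_det_gramMatrix (hK : IsBoxKernel K b c) (hM : (l : ℝ) + 1 ≤ m * h)
    (hx : ∀ i, x i ∈ Set.Icc h (1 - h)) : IsUnit (gramMatrix K l m h x).det := by
  rw [isUnit_iff_ne_zero]
  intro hdet
  obtain ⟨q, hq0, hq⟩ := Matrix.exists_mulVec_eq_zero_iff.2 hdet
  refine hq0 ((exists_grid_nodes hK hM hx q).1 fun k => ?_)
  have hMpos : 0 < (m : ℝ) * h := by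
    have : (0 : ℝ) ≤ l := l.cast_nonneg
    linarith
  have h0 := dotProduct_gramMatrix_mulVec K l m h x q q
  rw [hq, dotProduct_zero, eq_comm, mul_eq_zero] at h0
  have h1 := h0.resolve_left (by positivity)
  rw [Finset.sum_eq_zero_iff_of_nonneg fun k' _ =>
    mul_nonneg (Finset.prod_nonneg fun _ _ => hK.nonneg _) (mul_self_nonneg _)] at h1
  rw [sq]
  exact h1 k (Finset.mem_univ k)

lemma gramMatrix_transpose : (gramMatrix K l m h x).transpose = gramMatrix K l m h x := by
  ext r s
  simp only [Matrix.transpose_apply, gramMatrix]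
  congr 1
  exact Finset.sum_congr rfl fun k _ => by ring

/-- The weights reproduce polynomials of degree at most `l`. -/
lemma sum_interpWeight_mul_polyEval (hK : IsBoxKernel K b c) (hM : (l : ℝ) + 1 ≤ m * h)
    (hx : ∀ i, x i ∈ Set.Icc h (1 - h)) (q : MultiIdx d l → ℝ) :
    ∑ k, interpWeight K l m h x k * polyEval q (scaled m h x k) = q (MultiIdx.zero d l) := by
  have hdet := isUnit_det_gramMatrix hK hM hx
  have h1 : (gramMatrix K l m h x)⁻¹.mulVec ((gramMatrix K l m h x).mulVec q) = q := by
    rw [Matrix.mulVec_mulVec, Matrix.nonsing_inv_mul _ hdet, Matrix.one_mulVec]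
  rw [gramMatrix_mulVec K l m h x q, Matrix.mulVec_sum] at h1
  have h3 := congrFun h1 (MultiIdx.zero d l)
  rw [← h3, Finset.sum_apply]
  refine Finset.sum_congr rfl fun k _ => ?_
  rw [Matrix.mulVec_smul, Pi.smul_apply, smul_eq_mul, interpWeight]
  ring

/-- By symmetry of `B⁻¹`, one polynomial, with coefficient vector `B⁻¹ e₀`, serves all grid points.
This form makes Cauchy–Schwarz applicable to the Lebesgue constant. -/
lemma interpWeight_eq (K : ℝ → ℝ) (x : Fin d → ℝ) (k : Fin d → Fin m) :
    interpWeight K l m h x k = 1 / ((m : ℝ) * h) ^ d * (∏ j, K (scaled m h x k j))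
      * polyEval ((gramMatrix K l m h x)⁻¹.mulVec (Pi.single (MultiIdx.zero d l) 1))
          (scaled m h x k) := by
  unfold interpWeight polyEval
  congr 1
  have hsymm : ((gramMatrix K l m h x)⁻¹).transpose = (gramMatrix K l m h x)⁻¹ := by
    rw [Matrix.transpose_nonsing_inv, gramMatrix_transpose]
  simp only [Matrix.mulVec_single_one]
  refine Finset.sum_congr rfl fun s _ => ?_
  congr 1
  exact congrFun (congrFun hsymm.symm _) _

lemma interpWeight_eq_zero (hK : IsBoxKernel K b c) {k : Fin d → Fin m}
    (hk : ∃ j, scaled m h x k j ∉ Set.Icc (-1 : ℝ) 1) : interpWeight K l m h x k = 0 := by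
  obtain ⟨j, hj⟩ := hk
  rw [interpWeight, Finset.prod_eq_zero (Finset.mem_univ j) (hK.zero _ hj)]
  ring

/-- The number of grid points in a window. -/
lemma sum_kernel_le (hK : IsBoxKernel K b c) (hM : 1 ≤ m * h) (y : ℝ) :
    ∑ k : Fin m, K ((((k : ℕ) : ℝ) + 1 - m * y) / (m * h)) ≤ 3 * c * (m * h) := by
  have hMpos : 0 < (m : ℝ) * h := by linarith
  have hc : 0 < c := by
    have := hK.mem 0 (by simp)
    exact hK.pos.trans_le (this.1.trans this.2)
  set M := (m : ℝ) * h with hMdef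
  set s : Finset (Fin m) := Finset.univ.filter
    fun k => (((k : ℕ) : ℝ) + 1 - m * y) / M ∈ Set.Icc (-1 : ℝ) 1 with hs
  have h1 : ∑ k : Fin m, K ((((k : ℕ) : ℝ) + 1 - m * y) / M) ≤ ∑ _k ∈ s, c := by
    rw [← Finset.sum_filter_add_sum_filter_not Finset.univ
      (fun k : Fin m => (((k : ℕ) : ℝ) + 1 - m * y) / M ∈ Set.Icc (-1 : ℝ) 1)]
    rw [Finset.sum_eq_zero (s := Finset.univ.filter _) (fun k hk => hK.zero _ (Finset.mem_filter.1 hk).2),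
      add_zero]
    exact Finset.sum_le_sum fun k hk => (hK.mem _ (Finset.mem_filter.1 hk).2).2
  -- An interval of length `2M` contains at most `2M + 1 ≤ 3M` integers.
  have h2 : (s.card : ℝ) ≤ 3 * M := by
    have hsub : s.map ⟨fun k : Fin m => (((k : ℕ) : ℤ)), fun a b hab => Fin.ext (Int.ofNat.inj hab)⟩
        ⊆ Finset.Icc ⌈m * y - 1 - M⌉ ⌊m * y - 1 + M⌋ := by
      intro z hz
      rw [Finset.mem_map] at hz
      obtain ⟨k, hk, rfl⟩ := hz
      have hk' := (Finset.mem_filter.1 hk).2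
      rw [Set.mem_Icc, le_div_iff₀ hMpos, div_le_iff₀ hMpos] at hk'
      rw [Finset.mem_Icc, Int.ceil_le, Int.le_floor]
      change _ ≤ (((k : ℕ) : ℤ) : ℝ) ∧ (((k : ℕ) : ℤ) : ℝ) ≤ _
      rw [Int.cast_natCast]
      constructor <;> linarith [hk'.1, hk'.2]
    have hcard := Finset.card_le_card hsub
    rw [Finset.card_map, Int.card_Icc] at hcard
    have h3 : ((s.card : ℕ) : ℤ) ≤ max (⌊m * y - 1 + M⌋ + 1 - ⌈m * y - 1 - M⌉) 0 := by
      rw [← Int.toNat_eq_max]; exact_mod_cast hcard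
    have h4 : (s.card : ℝ) ≤ max (⌊m * y - 1 + M⌋ + 1 - ⌈m * y - 1 - M⌉ : ℝ) 0 := by
      exact_mod_cast h3
    refine h4.trans (max_le ?_ (by linarith))
    have := Int.floor_le (m * y - 1 + M)
    have := Int.le_ceil (m * y - 1 - M)
    linarith
  refine h1.trans ?_
  rw [Finset.sum_const, nsmul_eq_mul]
  nlinarith

lemma sum_prod_kernel_le (hK : IsBoxKernel K b c) (hm : 0 < m) (hM : 1 ≤ m * h) (x : Fin d → ℝ) :
    1 / ((m : ℝ) * h) ^ d * ∑ k : Fin d → Fin m, ∏ j, K (scaled m h x k j) ≤ (3 * c) ^ d := by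
  have hMpos : 0 < (m : ℝ) * h := by linarith
  have h1 : ∑ k : Fin d → Fin m, ∏ j, K (scaled m h x k j)
      = ∏ j, ∑ k : Fin m, K ((((k : ℕ) : ℝ) + 1 - m * x j) / (m * h)) := by
    rw [Finset.prod_univ_sum, Fintype.piFinset_univ]
    exact Finset.sum_congr rfl fun k _ => Finset.prod_congr rfl fun j _ => by rw [scaled_apply hm]
  rw [h1, one_div, inv_mul_le_iff₀ (by positivity), ← mul_pow]
  calc _ ≤ ∏ _j : Fin d, (3 * c * (m * h)) :=
        Finset.prod_le_prod (fun j _ => Finset.sum_nonneg fun _ _ => hK.nonneg _)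
          fun j _ => sum_kernel_le hK hM (x j)
    _ = _ := by rw [Finset.prod_const, Finset.card_univ, Fintype.card_fin]; ring

/-- The Lebesgue constant of the interpolation. -/
lemma sq_sum_abs_interpWeight_le (hK : IsBoxKernel K b c) (hM : (l : ℝ) + 1 ≤ m * h)
    (hx : ∀ i, x i ∈ Set.Icc h (1 - h)) :
    (∑ k, |interpWeight K l m h x k|) ^ 2
      ≤ (3 * c) ^ d * (((l : ℝ) + 1) ^ ((2 * l + 1) * d) * (m * h / b) ^ d) := by
  have hl : (0 : ℝ) ≤ l := l.cast_nonneg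
  have hm : 0 < m := by
    rcases Nat.eq_zero_or_pos m with h0 | h0
    · subst h0; simp at hM; linarith
    · exact h0
  have hMpos : 0 < (m : ℝ) * h := by linarith
  have hdet := isUnit_det_gramMatrix hK hM hx
  set v := (gramMatrix K l m h x)⁻¹.mulVec (Pi.single (MultiIdx.zero d l) 1) with hv
  set C := ((l : ℝ) + 1) ^ ((2 * l + 1) * d) * (m * h / b) ^ d with hC
  have hC0 : 0 ≤ C := by have := hK.pos; positivity
  have hvv : v ⬝ᵥ (gramMatrix K l m h x).mulVec v = v (MultiIdx.zero d l) := by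
    rw [hv, Matrix.mulVec_mulVec, Matrix.mul_nonsing_inv _ hdet, Matrix.one_mulVec, ← hv,
      dotProduct_single_one]
  have hv1 := (exists_grid_nodes hK hM hx v).2
  rw [hvv] at hv1
  set κ : (Fin d → Fin m) → ℝ := fun k => 1 / ((m : ℝ) * h) ^ d * (∏ j, K (scaled m h x k j)) with hκ
  have hκ0 : ∀ k, 0 ≤ κ k := fun k =>
    mul_nonneg (by positivity) (Finset.prod_nonneg fun _ _ => hK.nonneg _)
  have hquad : ∑ k, κ k * polyEval v (scaled m h x k) ^ 2 = v (MultiIdx.zero d l) := by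
    rw [← hvv, dotProduct_gramMatrix_mulVec, Finset.mul_sum]
    exact Finset.sum_congr rfl fun k _ => by simp only [hκ]; ring
  have hv0 : 0 ≤ v (MultiIdx.zero d l) := by
    rw [← hquad]
    exact Finset.sum_nonneg fun k _ => mul_nonneg (hκ0 k) (sq_nonneg _)
  -- The quadratic form at `v` equals `v₀` itself, so the node estimate reads `v₀² ≤ C v₀`; cancel
  -- `v₀`.
  have hvC : v (MultiIdx.zero d l) ≤ C := by
    rcases hv0.eq_or_lt with h0 | h0
    · rw [← h0]; exact hC0
    · rw [sq] at hv1
      exact le_of_mul_le_mul_right hv1 h0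
  have hκsum : ∑ k, κ k ≤ (3 * c) ^ d := by
    rw [hκ, ← Finset.mul_sum]
    exact sum_prod_kernel_le hK hm (by linarith) x
  calc (∑ k, |interpWeight K l m h x k|) ^ 2
      = (∑ k, √(κ k) * (√(κ k) * |polyEval v (scaled m h x k)|)) ^ 2 := by
        congr 1
        refine Finset.sum_congr rfl fun k _ => ?_
        rw [interpWeight_eq, abs_mul, ← mul_assoc, Real.mul_self_sqrt (hκ0 k), abs_of_nonneg (hκ0 k)]
    _ ≤ (∑ k, √(κ k) ^ 2) * ∑ k, (√(κ k) * |polyEval v (scaled m h x k)|) ^ 2 :=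
        Finset.sum_mul_sq_le_sq_mul_sq _ _ _
    _ = (∑ k, κ k) * v (MultiIdx.zero d l) := by
        rw [← hquad]
        congr 1
        · exact Finset.sum_congr rfl fun k _ => Real.sq_sqrt (hκ0 k)
        · exact Finset.sum_congr rfl fun k _ => by
            rw [mul_pow, Real.sq_sqrt (hκ0 k), sq_abs]
    _ ≤ (3 * c) ^ d * C := mul_le_mul hκsum hvC hv0
        ((Finset.sum_nonneg fun k _ => hκ0 k).trans hκsum)

end weights

/-! ### Taylor approximation of Hölder functions -/

/-- Here `φ k` is the `k`-th derivative of `φ 0`. The Taylor remainder vanishes at `0` and its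
derivative is the remainder of one order less for `φ 1`, so the mean value inequality on `[0,1]`
propagates the bound `M`. The gain of a factorial is not needed. -/
lemma abs_sub_taylor_le {M : ℝ} (l : ℕ) : ∀ φ : ℕ → ℝ → ℝ,
    (∀ k < l, ∀ t ∈ Set.Icc (0 : ℝ) 1, HasDerivWithinAt (φ k) (φ (k + 1) t) (Set.Icc 0 1) t) →
    (∀ t ∈ Set.Icc (0 : ℝ) 1, |φ l t - φ l 0| ≤ M) → ∀ t ∈ Set.Icc (0 : ℝ) 1,
      |φ 0 t - ∑ k ∈ Finset.range (l + 1), φ k 0 * (t ^ k / k.factorial)| ≤ M := by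
  induction l with
  | zero =>
    intro φ _ h t ht
    simpa using h t ht
  | succ l ih =>
    intro φ hd hM t ht
    have ih' := ih (fun k => φ (k + 1)) (fun k hk => hd (k + 1) (by omega)) hM
    have hM0 : 0 ≤ M := (abs_nonneg _).trans (hM t ht)
    have hder : ∀ s ∈ Set.Icc (0 : ℝ) 1, HasDerivWithinAt
        (fun s => φ 0 s - ∑ k ∈ Finset.range (l + 1 + 1), φ k 0 * (s ^ k / k.factorial))
        (φ 1 s - ∑ k ∈ Finset.range (l + 1), φ (k + 1) 0 * (s ^ k / k.factorial))
        (Set.Icc 0 1) s := by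
      intro s hs
      refine (hd 0 (by omega) s hs).sub ?_
      simp_rw [Finset.sum_range_succ' _ (l + 1)]
      simp only [pow_zero]
      refine HasDerivWithinAt.add_const _ ?_
      refine HasDerivWithinAt.fun_sum fun k _ => ?_
      refine HasDerivAt.hasDerivWithinAt ?_
      have h1 := ((hasDerivAt_pow (k + 1) s).div_const ((k + 1).factorial : ℝ)).const_mul
        (φ (k + 1) 0)
      refine h1.congr_deriv ?_
      congr 1
      rw [Nat.factorial_succ]
      have : (k.factorial : ℝ) ≠ 0 := by exact_mod_cast k.factorial_ne_zero
      have : ((k : ℝ) + 1) ≠ 0 := by positivity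
      push_cast
      field_simp
    have := norm_image_sub_le_of_norm_deriv_le_segment' hder
      (fun s hs => ih' s (Set.Ico_subset_Icc_self hs)) t ht
    rw [Finset.sum_range_succ' (fun k => φ k 0 * ((0 : ℝ) ^ k / k.factorial)) (l + 1)] at this
    simp only [ne_eq, Nat.add_eq_zero_iff, one_ne_zero, and_false, not_false_eq_true, zero_pow,
      zero_div, mul_zero, Finset.sum_const_zero, pow_zero, Nat.factorial_zero, Nat.cast_one,
      div_one, mul_one, zero_add, sub_self, sub_zero, Real.norm_eq_abs] at this
    exact this.trans (mul_le_of_le_one_right hM0 ht.2)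

lemma multilinear_apply_const {d k : ℕ}
    (f : ContinuousMultilinearMap ℝ (fun _ : Fin k => Fin d → ℝ) ℝ) (v : Fin d → ℝ) :
    f (fun _ => v) = ∑ i : Fin k → Fin d, (∏ j, v (i j)) * f (fun j => Pi.single (i j) 1) := by
  have hv : v = ∑ r, v r • (Pi.single r (1 : ℝ) : Fin d → ℝ) := by
    simpa using pi_eq_sum_univ' v
  conv_lhs => rw [hv]
  rw [ContinuousMultilinearMap.map_sum]
  refine Finset.sum_congr rfl fun i _ => ?_
  rw [ContinuousMultilinearMap.map_smul_univ, smul_eq_mul]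

/-- The space of polynomial functions of degree at most `l`. -/
def polySpace (d l : ℕ) : Submodule ℝ ((Fin d → ℝ) → ℝ) :=
  Submodule.span ℝ (Set.range fun (s : MultiIdx d l) (u : Fin d → ℝ) => polyVec l u s)

lemma exists_polyEval_of_mem {d l : ℕ} {f : (Fin d → ℝ) → ℝ} (hf : f ∈ polySpace d l) :
    ∃ q : MultiIdx d l → ℝ, ∀ u, f u = polyEval q u := by
  obtain ⟨q, hq⟩ := (Submodule.mem_span_range_iff_exists_fun ℝ).1 hf
  refine ⟨q, fun u => ?_⟩
  rw [← hq, Finset.sum_apply]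
  rfl

lemma prod_comp_mem_polySpace {d l k : ℕ} (hk : k ≤ l) (i : Fin k → Fin d) :
    (fun u : Fin d → ℝ => ∏ j, u (i j)) ∈ polySpace d l := by
  have hsum : ∑ r, (Finset.univ.filter fun j => i j = r).card = k := by
    rw [← Finset.card_eq_sum_card_fiberwise fun j _ => Finset.mem_univ (i j), Finset.card_univ,
      Fintype.card_fin]
  have hle : ∀ r, (Finset.univ.filter fun j => i j = r).card < l + 1 := fun r =>
    Nat.lt_succ_of_le (((Finset.card_le_univ _).trans_eq (Fintype.card_fin k)).trans hk)
  set s : MultiIdx d l := ⟨fun r => ⟨(Finset.univ.filter fun j => i j = r).card, hle r⟩,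
    hsum.trans_le hk⟩ with hs
  have : (fun u : Fin d → ℝ => ∏ j, u (i j))
      = (∏ r, (Nat.factorial (s.1 r) : ℝ)) • fun u => polyVec l u s := by
    funext u
    have hf : (∏ r, (Nat.factorial (s.1 r) : ℝ)) ≠ 0 :=
      Finset.prod_ne_zero_iff.2 fun i _ => by exact_mod_cast Nat.factorial_ne_zero _
    rw [Pi.smul_apply, smul_eq_mul, polyVec, mul_div_cancel₀ _ hf]
    rw [← Finset.prod_fiberwise' Finset.univ i (fun r => u r)]
    simp [hs, Finset.prod_const]
  rw [this]
  exact Submodule.smul_mem _ _ (Submodule.subset_span ⟨s, rfl⟩)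

lemma convex_cube (d : ℕ) : Convex ℝ (cube d) := convex_Icc 0 1

/-- A Hölder function is approximated by its Taylor polynomial. -/
lemma HolderClass.exists_polyEval {d : ℕ} {η L : ℝ} {g : (Fin d → ℝ) → ℝ}
    (hg : HolderClass η L g) (hL : 0 ≤ L) (hη : (holderOrder η : ℝ) ≤ η) {x : Fin d → ℝ}
    (hx : x ∈ cube d) {h : ℝ} (hh : h ≠ 0) :
    ∃ q : MultiIdx d (holderOrder η) → ℝ, q (MultiIdx.zero d _) = g x ∧ ∀ y ∈ cube d,
      |g y - polyEval q (fun j => (y j - x j) / h)| ≤ L * (∑ j, |y j - x j|) ^ η := by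
  set l := holderOrder η with hl
  set D : ∀ k : ℕ, (Fin d → ℝ) → ContinuousMultilinearMap ℝ (fun _ : Fin k => Fin d → ℝ) ℝ :=
    fun k => iteratedFDerivWithin ℝ k g (cube d) with hD
  -- The Taylor polynomial of `g` at `x`, in the rescaled variable `u = (y - x)/h`.
  set P : (Fin d → ℝ) → ℝ := fun u =>
    ∑ k ∈ Finset.range (l + 1), D k x (fun _ => h • u) * (1 / k.factorial) with hP
  have hPmem : P ∈ polySpace d l := by
    have : P = ∑ k ∈ Finset.range (l + 1), ∑ i : Fin k → Fin d,
        (h ^ k * D k x (fun j => Pi.single (i j) 1) * (1 / k.factorial)) •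
          fun u : Fin d → ℝ => ∏ j, u (i j) := by
      funext u
      simp only [hP, Finset.sum_apply, Pi.smul_apply, smul_eq_mul]
      refine Finset.sum_congr rfl fun k _ => ?_
      rw [multilinear_apply_const, Finset.sum_mul]
      refine Finset.sum_congr rfl fun i _ => ?_
      simp only [Pi.smul_apply, smul_eq_mul, Finset.prod_mul_distrib, Finset.prod_const,
        Finset.card_univ, Fintype.card_fin]
      ring
    rw [this]
    refine Submodule.sum_mem _ fun k hk => Submodule.sum_mem _ fun i _ =>
      Submodule.smul_mem _ _ (prod_comp_mem_polySpace ?_ i)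
    exact Nat.lt_succ_iff.1 (Finset.mem_range.1 hk)
  obtain ⟨q, hq⟩ := exists_polyEval_of_mem hPmem
  refine ⟨q, ?_, fun y hy => ?_⟩
  · rw [← polyEval_zero q, ← hq]
    simp only [hP, smul_zero]
    rw [Finset.sum_range_succ']
    rw [Finset.sum_eq_zero, zero_add]
    · simp [hD]
    · intro k _
      rw [(D (k + 1) x).map_coord_zero 0 rfl, zero_mul]
  · rw [← hq]
    set v : Fin d → ℝ := y - x with hv
    have hmem : ∀ t ∈ Set.Icc (0 : ℝ) 1, x + t • v ∈ cube d := fun t ht =>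
      (convex_cube d).add_smul_sub_mem hx hy ht
    have hhu : (h • fun j => (y j - x j) / h) = v := by
      funext j
      simp only [Pi.smul_apply, smul_eq_mul, hv, Pi.sub_apply]
      field_simp
    have hline : ∀ t, HasDerivWithinAt (fun t : ℝ => x + t • v) v (Set.Icc 0 1) t := fun t => by
      simpa using (((hasDerivAt_id t).smul_const v).const_add x).hasDerivWithinAt
    have hder : ∀ k < l, ∀ t ∈ Set.Icc (0 : ℝ) 1,
        HasDerivWithinAt (fun t : ℝ => D k (x + t • v) (fun _ => v))
          (D (k + 1) (x + t • v) (fun _ => v)) (Set.Icc 0 1) t := by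
      intro k hk t ht
      have h1 := (hg.1 k hk _ (hmem t ht)).hasFDerivWithinAt
      have h2 := h1.comp_hasDerivWithinAt t (hline t) hmem
      exact (ContinuousMultilinearMap.apply ℝ (fun _ : Fin k => Fin d → ℝ) ℝ
        (fun _ => v)).hasFDerivAt.comp_hasDerivWithinAt t h2
    have hbound : ∀ t ∈ Set.Icc (0 : ℝ) 1,
        |D l (x + t • v) (fun _ => v) - D l (x + (0 : ℝ) • v) (fun _ => v)|
          ≤ L * (∑ j, |v j|) ^ η := by
      intro t ht
      have hs0 : 0 ≤ ∑ j, |v j| := Finset.sum_nonneg fun _ _ => abs_nonneg _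
      rw [multilinear_apply_const, multilinear_apply_const, ← Finset.sum_sub_distrib]
      calc _ ≤ ∑ i : Fin l → Fin d, (∏ j, |v (i j)|) * (L * (∑ j, |v j|) ^ (η - l)) := by
            refine (Finset.abs_sum_le_sum_abs _ _).trans (Finset.sum_le_sum fun i _ => ?_)
            rw [← mul_sub, abs_mul, Finset.abs_prod]
            refine mul_le_mul_of_nonneg_left ?_ (Finset.prod_nonneg fun _ _ => abs_nonneg _)
            refine (hg.2 i _ (hmem t ht) _ (hmem 0 (by simp))).trans ?_
            refine mul_le_mul_of_nonneg_left ?_ hL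
            refine Real.rpow_le_rpow (Finset.sum_nonneg fun _ _ => abs_nonneg _) ?_ (by linarith)
            refine Finset.sum_le_sum fun j _ => ?_
            rw [zero_smul, add_zero, Pi.add_apply, Pi.smul_apply, smul_eq_mul,
              add_sub_cancel_left, abs_mul, abs_of_nonneg ht.1]
            exact mul_le_of_le_one_left (abs_nonneg _) ht.2
        _ = L * (∑ j, |v j|) ^ η := by
            rw [← Finset.sum_mul]
            -- The multinomial expansion produces exactly the `l`-th power of the `ℓ¹`-norm, which
            -- combines with the Hölder factor to the exponent `η`.
            have : ∑ i : Fin l → Fin d, ∏ j, |v (i j)| = (∑ j, |v j|) ^ l := by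
              rw [← Fintype.piFinset_univ, ← Finset.prod_univ_sum (fun _ => Finset.univ)
                (fun (_ : Fin l) r => |v r|)]
              simp
            rw [this, mul_left_comm, ← Real.rpow_natCast, ← Real.rpow_add_of_nonneg hs0
              (Nat.cast_nonneg _) (by linarith)]
            congr 2
            ring
    have := abs_sub_taylor_le l (fun k t => D k (x + t • v) (fun _ => v)) hder hbound 1 (by simp)
    simp only [one_smul, zero_smul, add_zero, one_pow] at this
    have hxy : x + v = y := by rw [hv]; abel
    rw [hxy] at this
    simp only [hP, hhu]
    have h0 : D 0 y (fun _ => v) = g y := by simp [hD]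
    rw [h0] at this
    simpa only [hv, Pi.sub_apply] using this

/-! ### Bounds for `Λ(d,l)` -/

section Lam

variable {d l : ℕ}

lemma two_le_ratio_pow (hd : 19 ≤ d) (hdl : d ≤ l) : (2 : ℝ) ≤ (((l : ℝ) + d) / d) ^ d := by
  have hd0 : (0 : ℝ) < d := by exact_mod_cast (by omega : 0 < d)
  have hdl' : (d : ℝ) ≤ l := by exact_mod_cast hdl
  have h2 : (2 : ℝ) ≤ ((l : ℝ) + d) / d := by
    rw [le_div_iff₀ hd0]; linarith
  exact h2.trans (le_self_pow₀ (by linarith) (by omega))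

/-- Since `8e²/π` is about `18.8`, the dimension `19` is the smallest one for which this holds. -/
lemma one_le_pi_mul_div (hd : 19 ≤ d) : 1 ≤ Real.pi * d / (8 * Real.exp 1 ^ 2) := by
  have hd' : (19 : ℝ) ≤ d := by exact_mod_cast hd
  have he := Real.exp_one_lt_d9
  have he0 := Real.exp_pos 1
  have hpi := Real.pi_gt_d2
  rw [le_div_iff₀ (by positivity)]
  nlinarith

lemma Lam_pos (hd : 19 ≤ d) (hdl : d ≤ l) : 0 < Lam d l := by
  have h1 := one_le_pi_mul_div hd
  have h2 := two_le_ratio_pow hd hdl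
  have hd0 : (0 : ℝ) < d := by exact_mod_cast (by omega : 0 < d)
  have hl0 : (0 : ℝ) ≤ l := l.cast_nonneg
  unfold Lam
  refine mul_pos (mul_pos (Real.rpow_pos_of_pos (by linarith) _)
    (Real.rpow_pos_of_pos (by linarith) _)) ?_
  exact one_div_pos.2 (Real.rpow_pos_of_pos (by linarith) _)

lemma inv_Lam_le (hd : 19 ≤ d) (hdl : d ≤ l) :
    (Lam d l)⁻¹ ≤ ((l : ℝ) + d) ^ (3 * (l : ℝ) * (Real.exp 1 * ((l : ℝ) + d) / d) ^ d) := by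
  have h1 := one_le_pi_mul_div hd
  have h2 := two_le_ratio_pow hd hdl
  have hd0 : (0 : ℝ) < d := by exact_mod_cast (by omega : 0 < d)
  have hl0 : (0 : ℝ) ≤ l := l.cast_nonneg
  have hN : 0 < ((l : ℝ) + d) ^ (3 * (l : ℝ) * (Real.exp 1 * ((l : ℝ) + d) / d) ^ d) :=
    Real.rpow_pos_of_pos (by linarith) _
  rw [inv_le_comm₀ (Lam_pos hd hdl) hN, Lam, ← one_div]
  refine le_mul_of_one_le_left (by positivity) ?_
  exact one_le_mul_of_one_le_of_one_le
    (Real.one_le_rpow h1 (by positivity)) (Real.one_le_rpow (by linarith) (by linarith))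

/-- With `N = l + d`, each of the two growing factors of `Λ` is at most `N^(lA)`, while the last one
is `N^(-3l e^d A)`. As `e^d ≥ 20` and `A ≥ 2`, the last one wins with room for `N^(4l)`. -/
lemma Lam_mul_pow_le_one (hd : 19 ≤ d) (hdl : d ≤ l) : Lam d l * ((l : ℝ) + d) ^ (4 * l) ≤ 1 := by
  have h1 := one_le_pi_mul_div hd
  have h2 := two_le_ratio_pow hd hdl
  have hd' : (19 : ℝ) ≤ d := by exact_mod_cast hd
  have hdl' : (d : ℝ) ≤ l := by exact_mod_cast hdl
  have hd0 : (0 : ℝ) < d := by linarith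
  set N : ℝ := (l : ℝ) + d with hN
  set A : ℝ := (N / d) ^ d with hA
  have hN1 : 1 ≤ N := by linarith
  have hN0 : 0 < N := by linarith
  have hE : (Real.exp 1 * N / d) ^ d = Real.exp 1 ^ d * A := by
    rw [mul_div_assoc, mul_pow]
  have hexp : (20 : ℝ) ≤ Real.exp 1 ^ d := by
    rw [← Real.exp_nat_mul, mul_one]
    linarith [Real.add_one_le_exp (d : ℝ)]
  have hf1 : (Real.pi * d / (8 * Real.exp 1 ^ 2)) ^ ((d : ℝ) * A) ≤ N ^ ((l : ℝ) * A) := by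
    calc _ ≤ N ^ ((d : ℝ) * A) := by
          refine Real.rpow_le_rpow (by linarith) ?_ (by positivity)
          rw [div_le_iff₀ (by positivity)]
          have := Real.pi_lt_d2
          have he := Real.add_one_le_exp (1 : ℝ)
          have he2 : 4 ≤ Real.exp 1 ^ 2 := by nlinarith
          have : N * 32 ≤ N * (8 * Real.exp 1 ^ 2) := by gcongr; linarith
          nlinarith
      _ ≤ _ := Real.rpow_le_rpow_of_exponent_le hN1 (by gcongr)
  have hf2 : (A - 1) ^ (A - 1) ≤ N ^ ((l : ℝ) * A) := by
    calc (A - 1) ^ (A - 1) ≤ A ^ (A - 1) :=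
          Real.rpow_le_rpow (by linarith) (by linarith) (by linarith)
      _ ≤ A ^ A := Real.rpow_le_rpow_of_exponent_le (by linarith) (by linarith)
      _ = (N / d) ^ ((d : ℝ) * A) := by
          rw [Real.rpow_mul (by positivity), Real.rpow_natCast]
      _ ≤ N ^ ((d : ℝ) * A) :=
          Real.rpow_le_rpow (by positivity) (div_le_self hN0.le (by linarith)) (by positivity)
      _ ≤ _ := Real.rpow_le_rpow_of_exponent_le hN1 (by gcongr)
  have hfN : N ^ (4 * l) = N ^ (4 * (l : ℝ)) := by
    rw [← Real.rpow_natCast]; push_cast; rfl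
  have hLam : Lam d l ≤ N ^ ((l : ℝ) * A) * N ^ ((l : ℝ) * A)
      * (1 / N ^ (3 * (l : ℝ) * (Real.exp 1 * N / d) ^ d)) := by
    unfold Lam
    rw [← hN, ← hA]
    have := Real.rpow_nonneg (show 0 ≤ A - 1 by linarith) (A - 1)
    gcongr
  calc Lam d l * N ^ (4 * l) ≤ N ^ ((l : ℝ) * A) * N ^ ((l : ℝ) * A)
      * (1 / N ^ (3 * (l : ℝ) * (Real.exp 1 * N / d) ^ d)) * N ^ (4 * (l : ℝ)) := by
        rw [hfN]; gcongr
    _ = N ^ ((l : ℝ) * A + (l : ℝ) * A - 3 * (l : ℝ) * (Real.exp 1 ^ d * A) + 4 * (l : ℝ)) := by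
        rw [Real.rpow_add hN0, Real.rpow_sub hN0, Real.rpow_add hN0, hE]
        ring
    _ ≤ 1 := by
        refine Real.rpow_le_one_of_one_le_of_nonpos hN1 ?_
        have hlA : 0 ≤ (l : ℝ) * (A - 2) := mul_nonneg (by linarith) (by linarith)
        have : 0 ≤ (l : ℝ) * A * (Real.exp 1 ^ d - 20) :=
          mul_nonneg (mul_nonneg (by linarith) (by linarith)) (by linarith)
        nlinarith

/-- Up to a factor `b/c ≤ 1`, the left side is the `d`-th root of the squared Lebesgue bound after
multiplication by `(b Λ l / c)^(2d)`. -/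
lemma mul_Lam_le_one (hd : 19 ≤ d) (hdl : d ≤ l) :
    12 * (l : ℝ) ^ 3 * ((l : ℝ) + 1) ^ (2 * l + 1) * (3 * Real.exp 1) ^ d * Lam d l ≤ 1 := by
  have hd' : (19 : ℝ) ≤ d := by exact_mod_cast hd
  have hdl' : (d : ℝ) ≤ l := by exact_mod_cast hdl
  have hL := Lam_pos hd hdl
  have h3e : (3 * Real.exp 1) ^ d ≤ ((l : ℝ) + 1) ^ l := by
    calc (3 * Real.exp 1) ^ d ≤ ((l : ℝ) + 1) ^ d := by
          have := Real.exp_one_lt_d9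
          have := Real.exp_pos 1
          gcongr
          linarith
      _ ≤ _ := pow_le_pow_right₀ (by linarith) hdl
  calc 12 * (l : ℝ) ^ 3 * ((l : ℝ) + 1) ^ (2 * l + 1) * (3 * Real.exp 1) ^ d * Lam d l
      ≤ ((l : ℝ) + 1) * ((l : ℝ) + 1) ^ 3 * ((l : ℝ) + 1) ^ (2 * l + 1) * ((l : ℝ) + 1) ^ l
        * Lam d l := by
        gcongr <;> linarith
    _ = Lam d l * ((l : ℝ) + 1) ^ (3 * l + 5) := by ring
    _ ≤ Lam d l * ((l : ℝ) + d) ^ (4 * l) := by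
        gcongr
        calc ((l : ℝ) + 1) ^ (3 * l + 5) ≤ ((l : ℝ) + 1) ^ (4 * l) :=
              pow_le_pow_right₀ (by linarith) (by omega)
          _ ≤ _ := by gcongr; linarith
    _ ≤ 1 := Lam_mul_pow_le_one hd hdl

lemma mul_Lam_le_one' (hd : 19 ≤ d) (hdl : d ≤ l) : Lam d l * l ≤ 1 := by
  have hd' : (19 : ℝ) ≤ d := by exact_mod_cast hd
  have hdl' : (d : ℝ) ≤ l := by exact_mod_cast hdl
  refine le_trans ?_ (Lam_mul_pow_le_one hd hdl)
  refine mul_le_mul_of_nonneg_left ?_ (Lam_pos hd hdl).le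
  calc (l : ℝ) ≤ (l : ℝ) + d := by linarith
    _ ≤ _ := le_self_pow₀ (by linarith) (by omega)

lemma Lam_le_one (hd : 19 ≤ d) (hdl : d ≤ l) : Lam d l ≤ 1 := by
  have hl : (1 : ℝ) ≤ l := by exact_mod_cast (by omega : 1 ≤ l)
  exact (le_mul_of_one_le_right (Lam_pos hd hdl).le hl).trans (mul_Lam_le_one' hd hdl)

end Lam

/-! ### The interpolation error -/

/-- The bound on `h` gives `d h ≤ z δ^(1/η)` with `z ≤ 1`, and `d ≤ l ≤ η` gives `(d h)^η ≤ z^d δ`.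
One part of `z^d` cancels the Lebesgue bound `W`, the other, `(2/(55(2L+1)))^d`, cancels `L`. -/
lemma lebesgue_mul_error_le {d l : ℕ} (hd : 19 ≤ d) (hdl : d ≤ l) {b c L η δ M h W : ℝ}
    (hb : 0 < b) (hbc : b ≤ c) (hL : 0 < L) (hη : (l : ℝ) ≤ η) (hδ : 0 < δ)
    (hM : M = 4 * l * (3 * Real.exp 1) ^ d / Lam d l) (hh : 0 ≤ h)
    (hh' : h ≤ 2 * b / (55 * (2 * L + 1) * c) * (Lam d l * l / d) * δ ^ (1 / η))
    (hW : W ^ 2 ≤ (3 * c) ^ d * (((l : ℝ) + 1) ^ ((2 * l + 1) * d) * (M / b) ^ d)) :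
    W * (L * (d * h) ^ η) ≤ δ := by
  have hd' : (19 : ℝ) ≤ d := by exact_mod_cast hd
  have hdl' : (d : ℝ) ≤ l := by exact_mod_cast hdl
  have hΛ := Lam_pos hd hdl
  have hc : 0 < c := hb.trans_le hbc
  have hη0 : 0 < η := by linarith
  set z : ℝ := b / c * (Lam d l * l) * (2 / (55 * (2 * L + 1))) with hz
  have hz0 : 0 ≤ z := by positivity
  have hr : b / c ≤ 1 := (div_le_one hc).2 hbc
  have hs1 : 2 / (55 * (2 * L + 1)) ≤ 1 := by
    rw [div_le_one (by positivity)]; linarith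
  have hLs : L * (2 / (55 * (2 * L + 1))) ≤ 1 := by
    rw [← mul_div_assoc, div_le_one (by positivity)]; linarith
  have hz1 : z ≤ 1 := by
    refine mul_le_one₀ (mul_le_one₀ hr (by positivity) (mul_Lam_le_one' hd hdl)) (by positivity) hs1
  have hdh : (d * h) ^ η ≤ z ^ d * δ := by
    calc (d * h) ^ η ≤ (z * δ ^ (1 / η)) ^ η := by
          refine Real.rpow_le_rpow (by positivity) ?_ hη0.le
          calc d * h ≤ d * (2 * b / (55 * (2 * L + 1) * c) * (Lam d l * l / d) * δ ^ (1 / η)) := by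
                gcongr
            _ = z * δ ^ (1 / η) := by
                rw [hz]; field_simp
      _ = z ^ η * δ := by
          rw [Real.mul_rpow hz0 (Real.rpow_nonneg hδ.le _), ← Real.rpow_mul hδ.le,
            one_div_mul_cancel hη0.ne', Real.rpow_one]
      _ ≤ z ^ d * δ := by
          rw [← Real.rpow_natCast z d]
          refine mul_le_mul_of_nonneg_right ?_ hδ.le
          exact Real.rpow_le_rpow_of_exponent_ge' hz0 hz1 (Nat.cast_nonneg _) (by linarith)
  have hLz : L * z ^ d ≤ (b / c * (Lam d l * l)) ^ d := by
    rw [hz, mul_pow _ (2 / (55 * (2 * L + 1))) d, mul_left_comm]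
    refine mul_le_of_le_one_right (by positivity) ?_
    refine le_trans ?_ hLs
    refine mul_le_mul_of_nonneg_left ?_ hL.le
    exact pow_le_of_le_one (by positivity) hs1 (by omega)
  have hWz : W * (b / c * (Lam d l * l)) ^ d ≤ 1 := by
    refine (le_abs_self _).trans ((sq_le_one_iff_abs_le_one _).1 ?_)
    calc (W * (b / c * (Lam d l * l)) ^ d) ^ 2
        ≤ (3 * c) ^ d * (((l : ℝ) + 1) ^ ((2 * l + 1) * d) * (M / b) ^ d)
          * ((b / c * (Lam d l * l)) ^ d) ^ 2 := by
          rw [mul_pow]; gcongr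
      _ = (12 * (l : ℝ) ^ 3 * ((l : ℝ) + 1) ^ (2 * l + 1) * (3 * Real.exp 1) ^ d * Lam d l
          * (b / c)) ^ d := by
          rw [pow_mul, ← mul_pow, ← mul_pow, ← pow_mul, mul_comm d 2, pow_mul, ← mul_pow, hM]
          congr 1
          field_simp
          ring
      _ ≤ 1 := pow_le_one₀ (by positivity)
          (mul_le_one₀ (mul_Lam_le_one hd hdl) (by positivity) hr)
  by_cases hW0 : W ≤ 0
  · refine le_trans (mul_nonpos_of_nonpos_of_nonneg hW0 (by positivity)) hδ.le
  · push Not at hW0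
    calc W * (L * (d * h) ^ η) ≤ W * (L * (z ^ d * δ)) := by gcongr
      _ = W * (L * z ^ d) * δ := by ring
      _ ≤ W * (b / c * (Lam d l * l)) ^ d * δ := by gcongr
      _ ≤ δ := mul_le_of_le_one_left hδ.le hWz

lemma gridPoint_mem_cube {d m : ℕ} (k : Fin d → Fin m) : gridPoint m k ∈ cube d := by
  constructor
  · intro i
    simp only [gridPoint, Pi.zero_apply]
    positivity
  · intro i
    have hlt := (k i).2
    have hm : (0 : ℝ) < m := by exact_mod_cast (Nat.zero_le _).trans_lt hlt
    simp only [gridPoint, Pi.one_apply]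
    rw [div_le_one hm]
    exact_mod_cast hlt

namespace Setup

variable {n d p : ℕ} (S : Setup n d p)

lemma Assumptions.isBoxKernel (hS : S.Assumptions) : IsBoxKernel S.kernel S.b S.c :=
  ⟨hS.b_pos, hS.kernel_mem, hS.kernel_zero⟩

lemma l_le_η (hl : 1 ≤ S.l) (hη : 0 < S.η) : (S.l : ℝ) ≤ S.η := by
  have h1 : S.l + 1 = ⌈S.η⌉₊ := by
    unfold l holderOrder at *; omega
  have h2 := Nat.ceil_lt_add_one hη.le
  rw [← h1] at h2
  push_cast at h2
  linarith

lemma margin_pos (hS : S.Assumptions) (hd : 19 ≤ d) (hl : d ≤ S.l) : 0 < S.margin := by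
  have := Lam_pos hd hl
  have := hS.b_pos
  have := hS.b_pos.trans_le hS.b_le_c
  have := hS.L₂_pos
  have : (0 : ℝ) < S.l := by exact_mod_cast (by omega : 0 < S.l)
  have : (0 : ℝ) < d := by exact_mod_cast (by omega : 0 < d)
  unfold margin
  positivity

lemma data_mem_cube (hS : S.Assumptions) (hd : 19 ≤ d) (hl : d ≤ S.l) (j : Fin n) :
    S.data j ∈ cube d := by
  have := S.margin_pos hS hd hl
  exact ⟨fun i => this.le.trans (hS.data_mem j i).1,
    fun i => (hS.data_mem j i).2.trans (by rw [Pi.one_apply]; linarith)⟩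

lemma δ_pos (hσ : 1 < S.σ) (ε : ℝ) : 0 < S.δ ε := by
  have : 1 / S.σ < 1 := (div_lt_one (by linarith)).2 hσ
  exact Real.rpow_pos_of_pos (by linarith) _

lemma δ_le_one (hσ : 1 < S.σ) (ε : ℝ) : S.δ ε ≤ 1 := by
  have : 1 / S.σ < 1 := (div_lt_one (by linarith)).2 hσ
  have : 0 < 1 / S.σ := by positivity
  exact Real.rpow_le_one (by linarith) (by linarith) (by positivity)

lemma m_pos (hS : S.Assumptions) (hd : 19 ≤ d) (hl : d ≤ S.l) (hσ : 1 < S.σ) (ε : ℝ) :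
    0 < S.m ε := by
  have := Lam_pos hd hl
  have := hS.b_pos
  have := hS.b_pos.trans_le hS.b_le_c
  have := hS.L₂_pos
  have : (0 : ℝ) < d := by exact_mod_cast (by omega : 0 < d)
  have := S.δ_pos hσ ε
  unfold m
  rw [Nat.ceil_pos]
  positivity

lemma m_mul_h (hS : S.Assumptions) (hd : 19 ≤ d) (hl : d ≤ S.l) (hσ : 1 < S.σ) (ε : ℝ) :
    S.m ε * S.h ε = 4 * S.l * (3 * Real.exp 1) ^ d / Lam d S.l := by
  have hm : (0 : ℝ) < S.m ε := by exact_mod_cast S.m_pos hS hd hl hσ ε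
  have := Lam_pos hd hl
  unfold h
  field_simp

/-- The number whose ceiling is `m` is exactly `m h` divided by the right side; the product `m h`
does not depend on `m`. -/
lemma h_le (hS : S.Assumptions) (hd : 19 ≤ d) (hl : d ≤ S.l) (hσ : 1 < S.σ) (ε : ℝ) :
    S.h ε ≤ S.margin * S.δ ε ^ (1 / S.η) := by
  have hm : (0 : ℝ) < S.m ε := by exact_mod_cast S.m_pos hS hd hl hσ ε
  have hΛ := Lam_pos hd hl
  have hb := hS.b_pos
  have hc := hS.b_pos.trans_le hS.b_le_c
  have hL := hS.L₂_pos
  have hd0 : (0 : ℝ) < d := by exact_mod_cast (by omega : 0 < d)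
  have hδ := S.δ_pos hσ ε
  have hM := S.margin_pos hS hd hl
  have hδη : 0 < S.δ ε ^ (1 / S.η) := Real.rpow_pos_of_pos hδ _
  have hmle := Nat.le_ceil (110 * (2 * S.L₂ + 1) * S.c / S.b * (d * (3 * Real.exp 1) ^ d / Lam d S.l ^ 2)
    * (1 / S.δ ε) ^ (1 / S.η))
  change _ ≤ (S.m ε : ℝ) at hmle
  refine le_of_mul_le_mul_left ?_ hm
  rw [S.m_mul_h hS hd hl hσ]
  calc 4 * S.l * (3 * Real.exp 1) ^ d / Lam d S.l
      = 110 * (2 * S.L₂ + 1) * S.c / S.b * (d * (3 * Real.exp 1) ^ d / Lam d S.l ^ 2)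
        * (1 / S.δ ε) ^ (1 / S.η) * (S.margin * S.δ ε ^ (1 / S.η)) := by
        rw [one_div (S.δ ε), Real.inv_rpow hδ.le, margin]
        field_simp
        ring
    _ ≤ _ := by gcongr

/-- The weights estimate each partial derivative in the parameter at each data point up to `δ`. -/
lemma abs_sum_interpWeight_sub_le (hS : S.Assumptions) (hd : 19 ≤ d) (hl : d ≤ S.l) (hσ : 1 < S.σ)
    (ε : ℝ) (j : Fin n) {g : (Fin d → ℝ) → ℝ} (hg : HolderClass S.η S.L₂ g) :
    |∑ k, interpWeight S.kernel S.l (S.m ε) (S.h ε) (S.data j) k * g (gridPoint (S.m ε) k)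
      - g (S.data j)| ≤ S.δ ε := by
  have hK := hS.isBoxKernel
  have hm0 := S.m_pos hS hd hl hσ ε
  have hm : (0 : ℝ) < S.m ε := by exact_mod_cast hm0
  have hmh := S.m_mul_h hS hd hl hσ ε
  have hΛ := Lam_pos hd hl
  have hl1 : (1 : ℝ) ≤ S.l := by exact_mod_cast (by omega : 1 ≤ S.l)
  have hη := S.l_le_η (by omega) hS.η_pos
  have hle := S.h_le hS hd hl hσ ε
  have hδ1 := S.δ_le_one hσ ε
  have hδ0 := S.δ_pos hσ ε
  have hh : 0 < S.h ε := by unfold h; positivity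
  have hh' : S.h ε ≤ S.margin := hle.trans (mul_le_of_le_one_right (S.margin_pos hS hd hl).le
    (Real.rpow_le_one hδ0.le hδ1 (by have := hS.η_pos; positivity)))
  have hM : (S.l : ℝ) + 1 ≤ S.m ε * S.h ε := by
    rw [hmh, le_div_iff₀ hΛ]
    have h1 : (1 : ℝ) ≤ (3 * Real.exp 1) ^ d :=
      one_le_pow₀ (by linarith [Real.add_one_le_exp (1 : ℝ)])
    have h2 := Lam_le_one hd hl
    calc ((S.l : ℝ) + 1) * Lam d S.l ≤ ((S.l : ℝ) + 1) * 1 := by gcongr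
      _ ≤ 4 * S.l * 1 := by linarith
      _ ≤ _ := by gcongr
  set x := S.data j with hx
  have hxw : ∀ i, x i ∈ Set.Icc (S.h ε) (1 - S.h ε) := fun i =>
    ⟨hh'.trans (hS.data_mem j i).1, (hS.data_mem j i).2.trans (by linarith)⟩
  obtain ⟨q, hq0, hq⟩ : ∃ q : MultiIdx d S.l → ℝ, q (MultiIdx.zero d S.l) = g x ∧ ∀ y ∈ cube d,
      |g y - polyEval q (fun j => (y j - x j) / S.h ε)| ≤ S.L₂ * (∑ j, |y j - x j|) ^ S.η :=
    hg.exists_polyEval hS.L₂_pos.le hη (S.data_mem_cube hS hd hl j) hh.ne'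
  -- Polynomial reproduction writes `g x` as the weighted sum of Taylor polynomial values, so only
  -- the Taylor errors at grid points within the window remain.
  rw [← hq0, ← sum_interpWeight_mul_polyEval hK hM hxw q, ← Finset.sum_sub_distrib]
  calc |∑ k, (interpWeight S.kernel S.l (S.m ε) (S.h ε) x k * g (gridPoint (S.m ε) k)
        - interpWeight S.kernel S.l (S.m ε) (S.h ε) x k * polyEval q (scaled (S.m ε) (S.h ε) x k))|
      ≤ ∑ k, |interpWeight S.kernel S.l (S.m ε) (S.h ε) x k| * (S.L₂ * (d * S.h ε) ^ S.η) := by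
        refine (Finset.abs_sum_le_sum_abs _ _).trans (Finset.sum_le_sum fun k _ => ?_)
        rw [← mul_sub, abs_mul]
        by_cases hk : ∃ i, scaled (S.m ε) (S.h ε) x k i ∉ Set.Icc (-1 : ℝ) 1
        · rw [interpWeight_eq_zero hK hk]; simp
        · push Not at hk
          refine mul_le_mul_of_nonneg_left ?_ (abs_nonneg _)
          refine (hq _ (gridPoint_mem_cube k)).trans ?_
          refine mul_le_mul_of_nonneg_left ?_ hS.L₂_pos.le
          refine Real.rpow_le_rpow (Finset.sum_nonneg fun _ _ => abs_nonneg _) ?_ hS.η_pos.le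
          calc ∑ i, |gridPoint (S.m ε) k i - x i| ≤ ∑ _i : Fin d, S.h ε := by
                refine Finset.sum_le_sum fun i _ => ?_
                have := abs_le.2 (hk i)
                rw [scaled, abs_div, abs_of_pos hh, div_le_one hh] at this
                exact this
            _ = d * S.h ε := by simp
    _ = (∑ k, |interpWeight S.kernel S.l (S.m ε) (S.h ε) x k|) * (S.L₂ * (d * S.h ε) ^ S.η) := by
        rw [Finset.sum_mul]
    _ ≤ S.δ ε := lebesgue_mul_error_le hd hl hS.b_pos hS.b_le_c hS.L₂_pos hη hδ0 hmh hh.le hle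
        (sq_sum_abs_interpWeight_le hK hM hxw)

end Setup

/-! ### Inexact gradient descent -/

/-- The descent lemma: after subtraction of the quadratic model, the function along the segment has
nonpositive derivative. -/
lemma le_of_lipschitz_gradient {E : Type*} [NormedAddCommGroup E] [InnerProductSpace ℝ E]
    [CompleteSpace E] {f : E → ℝ} {L : ℝ} (hf : Differentiable ℝ f)
    (hL : ∀ θ₁ θ₂, ‖gradient f θ₁ - gradient f θ₂‖ ≤ L * ‖θ₁ - θ₂‖) (θ v : E) :
    f (θ + v) ≤ f θ + inner ℝ (gradient f θ) v + L / 2 * ‖v‖ ^ 2 := by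
  set ψ : ℝ → ℝ := fun t =>
    f (θ + t • v) - (t * inner ℝ (gradient f θ) v + t ^ 2 * (L / 2 * ‖v‖ ^ 2)) with hψ
  have hline : ∀ t : ℝ, HasDerivAt (fun t : ℝ => θ + t • v) v t := fun t => by
    simpa using ((hasDerivAt_id t).smul_const v).const_add θ
  have hder : ∀ t : ℝ, HasDerivAt ψ (inner ℝ (gradient f (θ + t • v)) v
      - (1 * inner ℝ (gradient f θ) v + 2 * t * (L / 2 * ‖v‖ ^ 2))) t := by
    intro t
    have h1 := (hf (θ + t • v)).hasGradientAt.hasFDerivAt.comp_hasDerivAt t (hline t)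
    rw [InnerProductSpace.toDual_apply_apply] at h1
    refine h1.sub (((hasDerivAt_id t).mul_const _).add ?_)
    simpa using (hasDerivAt_pow 2 t).mul_const (L / 2 * ‖v‖ ^ 2)
  have hanti : AntitoneOn ψ (Set.Icc 0 1) := by
    refine antitoneOn_of_deriv_nonpos (convex_Icc 0 1)
      (fun t _ => (hder t).continuousAt.continuousWithinAt)
      (fun t _ => (hder t).differentiableAt.differentiableWithinAt) fun t ht => ?_
    rw [interior_Icc] at ht
    rw [(hder t).deriv]
    have h1 : inner ℝ (gradient f (θ + t • v) - gradient f θ) v ≤ t * (L * ‖v‖ ^ 2) := by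
      calc _ ≤ ‖gradient f (θ + t • v) - gradient f θ‖ * ‖v‖ := real_inner_le_norm _ _
        _ ≤ L * ‖θ + t • v - θ‖ * ‖v‖ := by gcongr; exact hL _ _
        _ = t * (L * ‖v‖ ^ 2) := by
          rw [add_sub_cancel_left, norm_smul, Real.norm_of_nonneg ht.1.le]; ring
    rw [inner_sub_left] at h1
    linarith
  have := hanti (Set.left_mem_Icc.2 zero_le_one) (Set.right_mem_Icc.2 zero_le_one) zero_le_one
  simp only [hψ, one_smul, zero_smul, add_zero] at this
  linarith

namespace Setup

variable {n d p : ℕ} (S : Setup n d p)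

/-- The gradient of the objective function. -/
def gradF (θ : Param p) : Param p := (1 / (n : ℝ)) • ∑ j, gradient (S.loss (S.data j)) θ

variable {S}

lemma F_add_le (hS : S.Assumptions) (hn : 0 < n) (hd : 19 ≤ d) (hl : d ≤ S.l) (θ v : Param p) :
    S.F (θ + v) ≤ S.F θ + inner ℝ (S.gradF θ) v + S.L₁ / 2 * ‖v‖ ^ 2 := by
  have hn' : (0 : ℝ) < n := by exact_mod_cast hn
  have h1 : ∑ j, S.loss (S.data j) (θ + v) ≤ ∑ j, (S.loss (S.data j) θ
      + inner ℝ (gradient (S.loss (S.data j)) θ) v + S.L₁ / 2 * ‖v‖ ^ 2) :=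
    Finset.sum_le_sum fun j _ => le_of_lipschitz_gradient
      (hS.differentiable _ (S.data_mem_cube hS hd hl j))
      (hS.lipschitz _ (S.data_mem_cube hS hd hl j)) θ v
  rw [Finset.sum_add_distrib, Finset.sum_add_distrib, ← sum_inner, Finset.sum_const,
    Finset.card_univ, Fintype.card_fin, nsmul_eq_mul] at h1
  unfold F gradF
  rw [real_inner_smul_left]
  calc _ ≤ 1 / (n : ℝ) * (_ + _ + _) := mul_le_mul_of_nonneg_left h1 (by positivity)
    _ = _ := by field_simp

lemma le_F (hS : S.Assumptions) (hn : 0 < n) (hd : 19 ≤ d) (hl : d ≤ S.l) (θ₁ θ₂ : Param p) :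
    S.F θ₂ + inner ℝ (S.gradF θ₂) (θ₁ - θ₂) + S.μ / 2 * ‖θ₁ - θ₂‖ ^ 2 ≤ S.F θ₁ := by
  have hn' : (0 : ℝ) < n := by exact_mod_cast hn
  have h1 := Finset.sum_le_sum fun j (_ : j ∈ Finset.univ) =>
    hS.strong_convex _ (S.data_mem_cube hS hd hl j) θ₁ θ₂
  rw [Finset.sum_add_distrib, Finset.sum_add_distrib, ← sum_inner, Finset.sum_const,
    Finset.card_univ, Fintype.card_fin, nsmul_eq_mul] at h1
  unfold F gradF
  rw [real_inner_smul_left]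
  calc _ = 1 / (n : ℝ) * (_ + _ + _) := by field_simp
    _ ≤ _ := mul_le_mul_of_nonneg_left h1 (by positivity)

/-- Minimize the strong convexity lower bound over `θ₁` by completing the square; this yields the
Polyak–Łojasiewicz inequality. -/
lemma F_sub_le (hS : S.Assumptions) (hn : 0 < n) (hd : 19 ≤ d) (hl : d ≤ S.l) (θ₁ θ₂ : Param p) :
    S.F θ₂ - ‖S.gradF θ₂‖ ^ 2 / (2 * S.μ) ≤ S.F θ₁ := by
  have hμ := hS.μ_pos
  refine le_trans ?_ (le_F hS hn hd hl θ₁ θ₂)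
  have h1 := neg_le_of_abs_le (abs_real_inner_le_norm (S.gradF θ₂) (θ₁ - θ₂))
  have h2 : ‖S.gradF θ₂‖ ^ 2 / (2 * S.μ) - ‖S.gradF θ₂‖ * ‖θ₁ - θ₂‖ + S.μ / 2 * ‖θ₁ - θ₂‖ ^ 2
      = (‖S.gradF θ₂‖ - S.μ * ‖θ₁ - θ₂‖) ^ 2 / (2 * S.μ) := by
    field_simp
    ring
  have h3 : 0 ≤ (‖S.gradF θ₂‖ - S.μ * ‖θ₁ - θ₂‖) ^ 2 / (2 * S.μ) := by positivity
  linarith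

lemma F_sub_le_Fstar (hS : S.Assumptions) (hn : 0 < n) (hd : 19 ≤ d) (hl : d ≤ S.l) (θ : Param p) :
    S.F θ - ‖S.gradF θ‖ ^ 2 / (2 * S.μ) ≤ S.Fstar :=
  le_ciInf fun θ₁ => F_sub_le hS hn hd hl θ₁ θ

lemma Fstar_le (hS : S.Assumptions) (hn : 0 < n) (hd : 19 ≤ d) (hl : d ≤ S.l) (θ : Param p) :
    S.Fstar ≤ S.F θ := by
  -- A real infimum is meaningful only for a set bounded below, and strong convexity supplies the
  -- bound.
  refine ciInf_le ⟨S.F 0 - ‖S.gradF 0‖ ^ 2 / (2 * S.μ), ?_⟩ θ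
  rintro _ ⟨θ₁, rfl⟩
  exact F_sub_le hS hn hd hl θ₁ 0

/-- With step `1/L₁`, the terms of the descent lemma complete to `(‖g - ∇F‖² - ‖∇F‖²)/(2L₁)`, and
the Polyak–Łojasiewicz inequality turns the negative part into contraction. -/
lemma inexact_step (hS : S.Assumptions) (hn : 0 < n) (hd : 19 ≤ d) (hl : d ≤ S.l) (θ g : Param p) :
    S.F (θ - (1 / S.L₁) • g) - S.Fstar
      ≤ (1 - 1 / S.σ) * (S.F θ - S.Fstar) + ‖g - S.gradF θ‖ ^ 2 / (2 * S.L₁) := by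
  have hμ := hS.μ_pos
  have hL := hS.L₁_pos
  have h1 := F_add_le hS hn hd hl θ (-((1 / S.L₁) • g))
  have h2 := F_sub_le_Fstar hS hn hd hl θ
  rw [← sub_eq_add_neg, inner_neg_right, real_inner_smul_right, norm_neg, norm_smul, mul_pow,
    Real.norm_of_nonneg (by positivity)] at h1
  have h3 := norm_sub_sq_real g (S.gradF θ)
  rw [real_inner_comm] at h3
  have h4 : S.F θ - S.Fstar ≤ ‖S.gradF θ‖ ^ 2 / (2 * S.μ) := by linarith
  have h5 : 1 / S.σ * (S.F θ - S.Fstar) ≤ ‖S.gradF θ‖ ^ 2 / (2 * S.L₁) := by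
    have : 0 ≤ 1 / S.σ := by unfold σ; positivity
    calc _ ≤ 1 / S.σ * (‖S.gradF θ‖ ^ 2 / (2 * S.μ)) := by gcongr
      _ = _ := by unfold σ; field_simp
  have h6 : -(1 / S.L₁ * inner ℝ (S.gradF θ) g) + S.L₁ / 2 * ((1 / S.L₁) ^ 2 * ‖g‖ ^ 2)
      = ‖g - S.gradF θ‖ ^ 2 / (2 * S.L₁) - ‖S.gradF θ‖ ^ 2 / (2 * S.L₁) := by
    rw [h3]
    field_simp
    ring
  linarith

lemma gradEstimate_error (hS : S.Assumptions) (hn : 0 < n) (hd : 19 ≤ d) (hl : d ≤ S.l)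
    (hσ : 1 < S.σ) (ε : ℝ) (θ : Param p) :
    ‖S.gradEstimate ε (fun k => S.oracle (gridPoint (S.m ε) k) θ) - S.gradF θ‖ ^ 2
      ≤ p * S.δ ε ^ 2 := by
  have hn' : (0 : ℝ) < n := by exact_mod_cast hn
  rw [EuclideanSpace.norm_sq_eq]
  calc _ ≤ ∑ _i : Fin p, S.δ ε ^ 2 := by
        refine Finset.sum_le_sum fun i _ => ?_
        refine pow_le_pow_left₀ (norm_nonneg _) ?_ 2
        have h1 : (S.gradEstimate ε (fun k => S.oracle (gridPoint (S.m ε) k) θ) - S.gradF θ) i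
            = 1 / (n : ℝ) * ∑ j, (∑ k, interpWeight S.kernel S.l (S.m ε) (S.h ε) (S.data j) k
              * gradient (S.loss (gridPoint (S.m ε) k)) θ i - gradient (S.loss (S.data j)) θ i) := by
          simp only [gradEstimate, gradF, oracle, PiLp.sub_apply, PiLp.smul_apply, smul_eq_mul,
            WithLp.ofLp_sum, Finset.sum_apply, Finset.sum_sub_distrib, mul_sub]
        rw [h1, Real.norm_eq_abs, abs_mul, abs_of_pos (by positivity : 0 < 1 / (n : ℝ)), one_div,
          inv_mul_le_iff₀ hn']
        calc _ ≤ ∑ _j : Fin n, S.δ ε := (Finset.abs_sum_le_sum_abs _ _).trans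
              (Finset.sum_le_sum fun j _ =>
                S.abs_sum_interpWeight_sub_le hS hd hl hσ ε j (hS.holder θ i))
          _ = _ := by simp
    _ = _ := by simp

/-- The quantity `X = p δ²/(2μ)` is the fixed point of the error recursion: each step adds `X/σ`,
and `(1 - 1/σ) X + X/σ = X`. -/
lemma run_gap_le (hS : S.Assumptions) (hn : 0 < n) (hd : 19 ≤ d) (hl : d ≤ S.l)
    (hσ : 1 < S.σ) (ε : ℝ) (t : ℕ) :
    S.F (S.run ε t).1 - S.Fstar
      ≤ (1 - 1 / S.σ) ^ t * (S.F S.θ₀ - S.Fstar) + p / (2 * S.μ) * S.δ ε ^ 2 := by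
  have hμ := hS.μ_pos
  have hL := hS.L₁_pos
  have hσ1 : 1 / S.σ < 1 := (div_lt_one (by linarith)).2 hσ
  induction t with
  | zero =>
    have : 0 ≤ p / (2 * S.μ) * S.δ ε ^ 2 := by positivity
    simpa [run] using this
  | succ t ih =>
    have h1 := inexact_step hS hn hd hl (S.run ε t).1
      (S.gradEstimate ε fun k => S.oracle (gridPoint (S.m ε) k) (S.run ε t).1)
    have h2 := gradEstimate_error hS hn hd hl hσ ε (S.run ε t).1
    calc S.F (S.run ε (t + 1)).1 - S.Fstar
        ≤ (1 - 1 / S.σ) * ((1 - 1 / S.σ) ^ t * (S.F S.θ₀ - S.Fstar) + p / (2 * S.μ) * S.δ ε ^ 2)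
          + p * S.δ ε ^ 2 / (2 * S.L₁) := by
          refine h1.trans ?_
          gcongr
      _ = _ := by
          have : p * S.δ ε ^ 2 / (2 * S.L₁) = 1 / S.σ * (p / (2 * S.μ) * S.δ ε ^ 2) := by
            unfold σ
            field_simp
          rw [this]
          ring

lemma run_snd (ε : ℝ) (t : ℕ) : (S.run ε t).2 = t * S.m ε ^ d := by
  induction t with
  | zero => simp [run]
  | succ t ih => simp [run, ih]; ring

lemma isApproxSol_run (hS : S.Assumptions) (hn : 0 < n) (hd : 19 ≤ d) (hl : d ≤ S.l)
    (hσ : 1 < S.σ) {ε : ℝ} (hε : 0 < ε) : S.IsApproxSol ε (S.run ε (S.T ε)).1 := by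
  have hμ := hS.μ_pos
  have hσ1 : 1 / S.σ < 1 := (div_lt_one (by linarith)).2 hσ
  have h0 : 0 < 1 - 1 / S.σ := by linarith
  set Q := S.F S.θ₀ - S.Fstar + p / (2 * S.μ) with hQ
  have hQ0 : 0 ≤ Q := add_nonneg (sub_nonneg.2 (Fstar_le hS hn hd hl _)) (by positivity)
  have hδ : S.δ ε ^ 2 = (1 - 1 / S.σ) ^ (S.T ε) := by
    rw [δ, ← Real.rpow_natCast, ← Real.rpow_mul h0.le, ← Real.rpow_natCast]
    congr 1
    push_cast
    ring
  have h1 := run_gap_le hS hn hd hl hσ ε (S.T ε)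
  rw [hδ] at h1
  refine h1.trans ?_
  rw [mul_comm (p / (2 * S.μ)), ← mul_add, ← hQ]
  -- For `Q = 0` the value `log 0 = 0` makes `T` uninformative, but then the bound on the gap is
  -- already zero.
  rcases hQ0.eq_or_lt with hz | hpos
  · rw [← hz, mul_zero]; exact hε.le
  have hr1 : 1 < S.σ / (S.σ - 1) := (one_lt_div (by linarith)).2 (by linarith)
  have hinv : 1 - 1 / S.σ = (S.σ / (S.σ - 1))⁻¹ := by
    have : S.σ ≠ 0 := by positivity
    rw [inv_div]; field_simp
  rw [hinv, inv_pow, inv_mul_le_iff₀ (by positivity), ← div_le_iff₀ hε]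
  have hT := Nat.le_ceil ((Real.log (S.σ / (S.σ - 1)))⁻¹ * Real.log (Q / ε))
  change _ ≤ (S.T ε : ℝ) at hT
  rw [inv_mul_le_iff₀ (Real.log_pos hr1)] at hT
  rw [← Real.log_le_log_iff (by positivity) (by positivity), Real.log_pow]
  linarith

/-- The oracle complexity is at most the number of calls in `T` iterations. -/
lemma Gam_le (hS : S.Assumptions) (hn : 0 < n) (hd : 19 ≤ d) (hl : d ≤ S.l)
    (hσ : 1 < S.σ) {ε : ℝ} (hε : 0 < ε) : S.Gam ε ≤ ((S.T ε * S.m ε ^ d : ℕ) : ℕ∞) := by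
  rw [← run_snd]
  exact iInf_le_of_le (S.T ε) (iInf_le_of_le le_rfl
    (iInf_le_of_le (isApproxSol_run hS hn hd hl hσ hε) le_rfl))

end Setup

/-! ### Bounds for `T`, `δ` and `m` -/

namespace Setup

variable {n d p : ℕ} {S : Setup n d p}

lemma T_le_log (hσ : 1 < S.σ) {ε R : ℝ} (hR : 1 ≤ R)
    (hQ0 : 0 ≤ (S.F S.θ₀ - S.Fstar + p / (2 * S.μ)) / ε)
    (hQ : (S.F S.θ₀ - S.Fstar + p / (2 * S.μ)) / ε ≤ R) :
    (S.T ε : ℝ) ≤ (Real.log (S.σ / (S.σ - 1)))⁻¹ * Real.log R + 1 := by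
  have hr1 : 1 < S.σ / (S.σ - 1) := (one_lt_div (by linarith)).2 (by linarith)
  have hlog := Real.log_pos hr1
  have hX : (Real.log (S.σ / (S.σ - 1)))⁻¹
      * Real.log ((S.F S.θ₀ - S.Fstar + p / (2 * S.μ)) / ε)
      ≤ (Real.log (S.σ / (S.σ - 1)))⁻¹ * Real.log R := by
    refine mul_le_mul_of_nonneg_left ?_ (by positivity)
    rcases hQ0.eq_or_lt with h0 | h0
    · rw [← h0, Real.log_zero]; exact Real.log_nonneg hR
    · exact Real.log_le_log h0 hQ
  have h2 : 0 ≤ (Real.log (S.σ / (S.σ - 1)))⁻¹ * Real.log R :=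
    mul_nonneg (by positivity) (Real.log_nonneg hR)
  exact (Nat.cast_le.2 (Nat.ceil_mono hX)).trans (Nat.ceil_lt_add_one h2).le

lemma inv_log_le (hσ : 1 < S.σ) : (Real.log (S.σ / (S.σ - 1)))⁻¹ ≤ S.σ := by
  have hr1 : 1 < S.σ / (S.σ - 1) := (one_lt_div (by linarith)).2 (by linarith)
  have h := Real.one_sub_inv_le_log_of_pos (by linarith : 0 < S.σ / (S.σ - 1))
  have hσ0 : S.σ ≠ 0 := by positivity
  rw [inv_le_comm₀ (Real.log_pos hr1) (by linarith)]
  refine le_of_eq_of_le ?_ h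
  rw [inv_div]
  field_simp
  ring

/-- With `r = σ/(σ-1)`, `1/δ = r^(T/2)`; the main term of `T` contributes `R^(1/2)` and the rounding
at most `r^(1/2)`. -/
lemma inv_δ_le (hσ : 1 < S.σ) {ε R : ℝ} (hR : 1 ≤ R)
    (hQ0 : 0 ≤ (S.F S.θ₀ - S.Fstar + p / (2 * S.μ)) / ε)
    (hQ : (S.F S.θ₀ - S.Fstar + p / (2 * S.μ)) / ε ≤ R) :
    1 / S.δ ε ≤ (S.σ / (S.σ - 1) * R) ^ (1 / 2 : ℝ) := by
  have hr1 : 1 < S.σ / (S.σ - 1) := (one_lt_div (by linarith)).2 (by linarith)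
  set r := S.σ / (S.σ - 1) with hr
  have hr0 : 0 < r := by linarith
  have hσ0 : S.σ ≠ 0 := by positivity
  have hinv : 1 - 1 / S.σ = r⁻¹ := by
    rw [hr, inv_div]; field_simp
  have hlog := Real.log_pos hr1
  have hT := T_le_log hσ hR hQ0 hQ
  rw [← hr] at hT
  rw [δ, hinv, Real.inv_rpow hr0.le, one_div, inv_inv]
  calc r ^ ((S.T ε : ℝ) / 2) ≤ r ^ (((Real.log r)⁻¹ * Real.log R + 1) * (1 / 2 : ℝ)) :=
        Real.rpow_le_rpow_of_exponent_le hr1.le (by linarith)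
    _ = (r * R) ^ (1 / 2 : ℝ) := by
        rw [Real.rpow_mul hr0.le, Real.rpow_add hr0, Real.rpow_one, Real.rpow_def_of_pos hr0,
          mul_inv_cancel_left₀ hlog.ne', Real.exp_log (by linarith), mul_comm]

lemma m_pow_le (hS : S.Assumptions) (hd : 19 ≤ d) (hl : d ≤ S.l) (hσ : 1 < S.σ) {ε κ : ℝ}
    (hκ : 110 * (2 * S.L₂ + 1) * S.c / S.b ≤ κ) :
    (S.m ε : ℝ) ^ d ≤ (2 * κ * (d * (3 * Real.exp 1) ^ d / Lam d S.l ^ 2)) ^ d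
      * (1 / S.δ ε) ^ ((d : ℝ) / S.η) := by
  have hΛ := Lam_pos hd hl
  have hΛ1 := Lam_le_one hd hl
  have hb := hS.b_pos
  have hc := hS.b_pos.trans_le hS.b_le_c
  have hL := hS.L₂_pos
  have hη := hS.η_pos
  have hd1 : (1 : ℝ) ≤ d := by exact_mod_cast (by omega : 1 ≤ d)
  have hδ := S.δ_pos hσ ε
  have hδ1 : 1 ≤ 1 / S.δ ε := (one_le_div hδ).2 (S.δ_le_one hσ ε)
  set Y := d * (3 * Real.exp 1) ^ d / Lam d S.l ^ 2 with hY
  have hY1 : 1 ≤ Y := by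
    rw [hY, one_le_div (by positivity)]
    calc Lam d S.l ^ 2 ≤ 1 := pow_le_one₀ hΛ.le hΛ1
      _ ≤ _ := one_le_mul_of_one_le_of_one_le hd1
        (one_le_pow₀ (by linarith [Real.add_one_le_exp (1 : ℝ)]))
  have hk1 : 1 ≤ 110 * (2 * S.L₂ + 1) * S.c / S.b := by
    rw [one_le_div hb]
    nlinarith [hS.b_le_c, mul_pos hL hc]
  have hZ1 : 1 ≤ (1 / S.δ ε) ^ (1 / S.η) := Real.one_le_rpow hδ1 (by positivity)
  have hX1 : 1 ≤ 110 * (2 * S.L₂ + 1) * S.c / S.b * Y * (1 / S.δ ε) ^ (1 / S.η) :=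
    one_le_mul_of_one_le_of_one_le (one_le_mul_of_one_le_of_one_le hk1 hY1) hZ1
  have hm : (S.m ε : ℝ) ≤ 2 * κ * Y * (1 / S.δ ε) ^ (1 / S.η) := by
    calc (S.m ε : ℝ) ≤ 110 * (2 * S.L₂ + 1) * S.c / S.b * Y * (1 / S.δ ε) ^ (1 / S.η) + 1 :=
          (Nat.ceil_lt_add_one (by linarith)).le
      _ ≤ 2 * (110 * (2 * S.L₂ + 1) * S.c / S.b) * Y * (1 / S.δ ε) ^ (1 / S.η) := by linarith
      _ ≤ _ := by gcongr
  calc (S.m ε : ℝ) ^ d ≤ (2 * κ * Y * (1 / S.δ ε) ^ (1 / S.η)) ^ d := by gcongr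
    _ = _ := by
        rw [mul_pow, ← Real.rpow_natCast ((1 / S.δ ε) ^ (1 / S.η)), ← Real.rpow_mul (by positivity)]
        congr 2
        ring

end Setup

/-- The dominant contribution is `Λ⁻¹`, with logarithm at most `3γ(γ+1) d² E`, where `E =
(e(γ+1))^d`; the outer power `d` makes this `d³ E`. -/
lemma dimension_factor_le {d l : ℕ} (hd : 19 ≤ d) (hdl : d ≤ l) {γ κ : ℝ} (hγ : 1 < γ)
    (hlγ : (l : ℝ) ≤ γ * d) (hκ : 0 ≤ κ) :
    (2 * κ * (d * (3 * Real.exp 1) ^ d / Lam d l ^ 2)) ^ d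
      ≤ Real.exp ((2 * κ + 4 + 6 * γ * (γ + 1)) * (d : ℝ) ^ 3 * (Real.exp 1 * (γ + 1)) ^ d) := by
  have hd1 : (1 : ℝ) ≤ d := by exact_mod_cast (by omega : 1 ≤ d)
  have hd0 : (0 : ℝ) < d := by linarith
  have hdl' : (d : ℝ) ≤ l := by exact_mod_cast hdl
  have he := Real.add_one_le_exp (1 : ℝ)
  have hΛ := Lam_pos hd hdl
  set E : ℝ := (Real.exp 1 * (γ + 1)) ^ d with hE
  have hE1 : 1 ≤ E := one_le_pow₀ (by nlinarith)
  have hN : (l : ℝ) + d ≤ (γ + 1) * d := by linarith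
  have hEl : (Real.exp 1 * ((l : ℝ) + d) / d) ^ d ≤ E := by
    refine pow_le_pow_left₀ (by positivity) ?_ d
    rw [div_le_iff₀ hd0, mul_assoc]
    gcongr
  have hinv : (Lam d l)⁻¹ ≤ Real.exp (3 * γ * (γ + 1) * (d : ℝ) ^ 2 * E) := by
    refine (inv_Lam_le hd hdl).trans ?_
    rw [Real.rpow_def_of_pos (by linarith), Real.exp_le_exp]
    have hlog : Real.log ((l : ℝ) + d) ≤ (γ + 1) * d :=
      (Real.log_le_self (by linarith)).trans hN
    have hlog0 : 0 ≤ Real.log ((l : ℝ) + d) := Real.log_nonneg (by linarith)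
    calc Real.log ((l : ℝ) + d) * (3 * l * (Real.exp 1 * ((l : ℝ) + d) / d) ^ d)
        ≤ ((γ + 1) * d) * (3 * (γ * d) * E) := by gcongr
      _ = _ := by ring
  have h3e : (3 * Real.exp 1) ^ d ≤ Real.exp (3 * d) := by
    rw [mul_comm 3 (d : ℝ), Real.exp_nat_mul]
    refine pow_le_pow_left₀ (by positivity) ?_ d
    have : Real.exp 3 = Real.exp 1 * (Real.exp 1 * Real.exp 1) := by
      rw [← Real.exp_add, ← Real.exp_add]; norm_num
    rw [this]
    have h22 : 3 ≤ Real.exp 1 * Real.exp 1 := by nlinarith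
    nlinarith
  have hself : ∀ x : ℝ, x ≤ Real.exp x := fun x => by linarith [Real.add_one_le_exp x]
  have hbase : 2 * κ * (d * (3 * Real.exp 1) ^ d / Lam d l ^ 2)
      ≤ Real.exp (2 * κ + (d + 3 * d + 2 * (3 * γ * (γ + 1) * (d : ℝ) ^ 2 * E))) := by
    rw [Real.exp_add, Real.exp_add, Real.exp_add, two_mul (3 * γ * _ * _ * _), Real.exp_add, ← sq,
      div_eq_mul_inv, ← inv_pow]
    gcongr
    · exact hself _
    · exact hself _
  calc _ ≤ Real.exp (2 * κ + (d + 3 * d + 2 * (3 * γ * (γ + 1) * (d : ℝ) ^ 2 * E))) ^ d := by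
        gcongr
    _ = Real.exp (d * (2 * κ + (d + 3 * d + 2 * (3 * γ * (γ + 1) * (d : ℝ) ^ 2 * E)))) := by
        rw [Real.exp_nat_mul]
    _ ≤ _ := by
        rw [Real.exp_le_exp]
        have h1 : (d : ℝ) ≤ (d : ℝ) ^ 3 * E := by
          calc (d : ℝ) = (d : ℝ) ^ 1 * 1 := by ring
            _ ≤ (d : ℝ) ^ 3 * E := by gcongr; norm_num
        have h2 : (d : ℝ) ^ 2 ≤ (d : ℝ) ^ 3 * E := by
          calc (d : ℝ) ^ 2 = (d : ℝ) ^ 2 * 1 := by ring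
            _ ≤ (d : ℝ) ^ 3 * E := by gcongr; norm_num
        have h3 := mul_le_mul_of_nonneg_left h1 hκ
        nlinarith

/-- Eventually `C d³ ≤ a^d`. The dimension need not tend to infinity, so the finitely many
exceptions go into `C'`. -/
lemma exists_mul_pow_le_pow_add (C : ℝ) {a : ℝ} (ha : 1 < a) :
    ∃ C' : ℝ, ∀ d : ℕ, C * (d : ℝ) ^ 3 * a ^ d ≤ a ^ (2 * d) + C' := by
  have ht : Tendsto (fun d : ℕ => C * ((d : ℝ) ^ 3 / a ^ d)) atTop (𝓝 (C * 0)) :=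
    (tendsto_pow_const_div_const_pow_of_one_lt 3 ha).const_mul C
  rw [mul_zero] at ht
  obtain ⟨N, hN⟩ := eventually_atTop.1 (ht.eventually_le_const zero_lt_one)
  refine ⟨∑ d ∈ Finset.range N, |C * (d : ℝ) ^ 3 * a ^ d|, fun d => ?_⟩
  have ha0 : 0 < a := by linarith
  have hsum : 0 ≤ ∑ d ∈ Finset.range N, |C * (d : ℝ) ^ 3 * a ^ d| :=
    Finset.sum_nonneg fun _ _ => abs_nonneg _
  rcases lt_or_ge d N with h | h
  · have h1 := Finset.single_le_sum (f := fun d : ℕ => |C * (d : ℝ) ^ 3 * a ^ d|)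
      (fun _ _ => abs_nonneg _) (Finset.mem_range.2 h)
    have h2 : 0 < a ^ (2 * d) := by positivity
    have h3 := le_abs_self (C * (d : ℝ) ^ 3 * a ^ d)
    linarith
  · have h1 := hN d h
    rw [← mul_div_assoc, div_le_one (by positivity)] at h1
    have h2 : C * (d : ℝ) ^ 3 * a ^ d ≤ a ^ d * a ^ d := by gcongr
    rw [two_mul, pow_add]
    linarith

lemma pow_le_sqrt_log {a : ℝ} (ha : 1 < a) {d n : ℕ} (hn : 0 < Real.log n)
    (hd : (d : ℝ) ≤ Real.log (Real.log n) / (4 * Real.log a)) : a ^ (2 * d) ≤ √(Real.log n) := by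
  have hlog := Real.log_pos ha
  have ha0 : 0 < a := by linarith
  refine Real.le_sqrt_of_sq_le ?_
  rw [le_div_iff₀ (by positivity)] at hd
  rw [← pow_mul, ← Real.log_le_log_iff (by positivity) hn, Real.log_pow]
  push_cast
  linarith

/-! ### Asymptotics -/

lemma exists_eventually_abs_le {f g : ℕ → ℝ} (h : f =O[atTop] g) :
    ∃ C : ℝ, 1 ≤ C ∧ ∀ᶠ n in atTop, |f n| ≤ C * |g n| := by
  obtain ⟨C, hC⟩ := h.bound
  refine ⟨max 1 C, le_max_left _ _, hC.mono fun n hn => hn.trans ?_⟩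
  rw [Real.norm_eq_abs]
  gcongr
  exact le_max_right _ _

/-- With `x = √(log n)`, the subpolynomial factor is at most `exp (4x)`, and completing the square
gives `4x ≤ κx²/2 + 8/κ`. This costs only half of the gap `κ` between the exponents. -/
lemma isLittleO_log_mul_exp_sqrt_mul_rpow {s t : ℝ} (hst : s < t) :
    (fun n : ℕ => Real.log n * Real.exp (2 * √(Real.log n)) * (n : ℝ) ^ s)
      =o[atTop] fun n : ℕ => (n : ℝ) ^ t := by
  set κ := t - s with hκ
  have hκ0 : 0 < κ := sub_pos.2 hst
  have hbig : (fun n : ℕ => Real.log n * Real.exp (2 * √(Real.log n)) * (n : ℝ) ^ s)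
      =O[atTop] fun n : ℕ => (n : ℝ) ^ (s + κ / 2) := by
    refine IsBigO.of_bound (Real.exp (8 / κ)) ?_
    filter_upwards [eventually_ge_atTop 1] with n hn
    have hn1 : (1 : ℝ) ≤ n := by exact_mod_cast hn
    have hn0 : (0 : ℝ) < n := by linarith
    set L := Real.log n with hL
    have hL0 : 0 ≤ L := Real.log_nonneg hn1
    set x := √L with hx
    have hx0 : 0 ≤ x := Real.sqrt_nonneg L
    have hxL : L = x ^ 2 := (Real.sq_sqrt hL0).symm
    have hLe : L ≤ Real.exp (2 * x) := by
      rw [two_mul, Real.exp_add, hxL, sq]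
      have := Real.add_one_le_exp x
      gcongr <;> linarith
    rw [Real.norm_of_nonneg (by positivity), Real.norm_of_nonneg (by positivity),
      Real.rpow_def_of_pos hn0, Real.rpow_def_of_pos hn0, ← hL]
    calc L * Real.exp (2 * x) * Real.exp (L * s)
        ≤ Real.exp (2 * x) * Real.exp (2 * x) * Real.exp (L * s) := by gcongr
      _ = Real.exp (2 * x + 2 * x + L * s) := by rw [Real.exp_add, Real.exp_add]
      _ ≤ Real.exp (8 / κ + L * (s + κ / 2)) := by
          rw [Real.exp_le_exp]
          have h1 : 0 ≤ (κ * x - 4) ^ 2 / (2 * κ) := by positivity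
          have h2 : (κ * x - 4) ^ 2 / (2 * κ) = κ / 2 * x ^ 2 - 4 * x + 8 / κ := by
            field_simp
            ring
          rw [hxL]
          linarith
      _ = _ := by rw [Real.exp_add]
  refine hbig.trans_isLittleO ?_
  refine (isLittleO_iff_tendsto' ?_).2 ?_
  · filter_upwards [eventually_ge_atTop 1] with n hn h0
    have hn0 : (0 : ℝ) < n := by exact_mod_cast hn
    exact absurd h0 (Real.rpow_pos_of_pos hn0 t).ne'
  · have h1 := (tendsto_rpow_neg_atTop (half_pos hκ0)).comp (tendsto_natCast_atTop_atTop (R := ℝ))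
    refine h1.congr' ?_
    filter_upwards [eventually_ge_atTop 1] with n hn
    have hn0 : (0 : ℝ) < n := by exact_mod_cast hn
    rw [← Real.rpow_sub hn0, Function.comp_apply]
    congr 1
    rw [hκ]
    ring

end LPIGD

end

/-! ### The complexity bound and the comparison with GD and SGD -/

theorem proposition3
    (α β τ γ : ℝ) (hα : 0 < α) (hβ : 0 < β) (hτ : max 1 α⁻¹ < τ)
    (hγ : max 1 (τ * (α + β) / 2) < γ)
    (d p : ℕ → ℕ) (ε : ℕ → ℝ) (S : ∀ n : ℕ, LPIGD.Setup n (d n) (p n))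
    (hS : ∀ᶠ n in atTop, (S n).Assumptions)
    -- scaling of the accuracy, the number of parameters, the dimension and the smoothness
    (hε_pos : ∀ᶠ n in atTop, 0 < ε n)
    (hε : ε =Θ[atTop] fun n => (n : ℝ) ^ (-α))
    (hp : (fun n => (p n : ℝ)) =O[atTop] fun n => (n : ℝ) ^ β)
    (hd19 : ∀ᶠ n in atTop, 19 ≤ d n)
    (hd : ∀ᶠ n in atTop,
      (d n : ℝ) ≤ Real.log (Real.log n) / (4 * Real.log (Real.exp 1 * (γ + 1))))
    (hη : (fun n => (S n).η) =Θ[atTop] fun n => (d n : ℝ))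
    (hη_ge : ∀ᶠ n in atTop, τ * (α + β) * d n / 2 ≤ (S n).η)
    (hl : ∀ᶠ n in atTop, d n ≤ (S n).l ∧ ((S n).l : ℝ) ≤ γ * d n)
    -- the remaining quantities are `Θ(1)`, and the condition number stays away from `1`
    (hμ : (fun n => (S n).μ) =Θ[atTop] fun _ => (1 : ℝ))
    (hL₁ : (fun n => (S n).L₁) =Θ[atTop] fun _ => (1 : ℝ))
    (hσ : ∃ σ₀ : ℝ, 1 < σ₀ ∧ ∀ᶠ n in atTop, σ₀ ≤ (S n).σ)
    (hL₂ : (fun n => (S n).L₂) =Θ[atTop] fun _ => (1 : ℝ))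
    (hb : (fun n => (S n).b) =Θ[atTop] fun _ => (1 : ℝ))
    (hc : (fun n => (S n).c) =Θ[atTop] fun _ => (1 : ℝ))
    (hF : (fun n => (S n).F (S n).θ₀ - (S n).Fstar) =Θ[atTop] fun _ => (1 : ℝ)) :
    -- the oracle complexity is (eventually) a finite number
    (∀ᶠ n in atTop, (S n).Gam (ε n) ≠ ⊤) ∧
    ((fun n => (((S n).Gam (ε n)).toNat : ℝ)) =O[atTop]
      fun n => Real.log n * Real.exp (2 * √(Real.log n)) * (n : ℝ) ^ (1 / τ)) ∧
    (∀ GammaGD : ℕ → ℝ,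
      GammaGD =Θ[atTop] (fun n => (n : ℝ) * Real.log (1 / ε n)) →
      Tendsto (fun n => (((S n).Gam (ε n)).toNat : ℝ) / GammaGD n) atTop (𝓝 0)) ∧
    (∀ GammaSGD : ℕ → ℝ,
      GammaSGD =Θ[atTop] (fun n => 1 / ε n) →
      Tendsto (fun n => (((S n).Gam (ε n)).toNat : ℝ) / GammaSGD n) atTop (𝓝 0)) := by
  have hτ1 : 1 < τ := (le_max_left _ _).trans_lt hτ
  have hτα : 1 / τ < α := by
    rw [one_div]
    exact inv_lt_of_inv_lt₀ hα ((le_max_right _ _).trans_lt hτ)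
  have hγ1 : 1 < γ := (le_max_left _ _).trans_lt hγ
  obtain ⟨σ₀, hσ₀, hσ⟩ := hσ
  have ha : 1 < Real.exp 1 * (γ + 1) := by nlinarith [Real.add_one_le_exp (1 : ℝ)]
  have hninv : (fun n => (ε n)⁻¹) =Θ[atTop] fun n : ℕ => (n : ℝ) ^ α := by
    refine hε.inv.trans (IsTheta.of_norm_eventuallyEq_norm (Eventually.of_forall fun n => ?_))
    simp only [Real.rpow_neg n.cast_nonneg, inv_inv]
  -- the logarithmic term of `T`
  have hone : (fun _ : ℕ => (1 : ℝ)) =O[atTop] fun n : ℕ => (n : ℝ) ^ β := by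
    refine IsBigO.of_bound 1 ?_
    filter_upwards [eventually_ge_atTop 1] with n hn
    have hn1 : (1 : ℝ) ≤ n := by exact_mod_cast hn
    rw [one_mul, norm_one, Real.norm_of_nonneg (by positivity)]
    exact Real.one_le_rpow hn1 hβ.le
  have hQ : (fun n => ((S n).F (S n).θ₀ - (S n).Fstar + p n / (2 * (S n).μ)) / ε n)
      =O[atTop] fun n : ℕ => (n : ℝ) ^ (α + β) := by
    have h1 : (fun n => (p n : ℝ) * ((S n).μ)⁻¹) =O[atTop] fun n : ℕ => (n : ℝ) ^ β := by
      simpa using hp.mul hμ.inv.1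
    have h2 := ((hF.1.trans hone).add (h1.const_mul_left (1 / 2))).mul hninv.1
    refine (h2.congr' (Eventually.of_forall fun n => ?_) ?_)
    · simp only [div_eq_mul_inv, mul_inv]
      ring
    · filter_upwards [eventually_ge_atTop 1] with n hn
      have hn0 : (0 : ℝ) < n := by exact_mod_cast hn
      rw [← Real.rpow_add hn0, add_comm]
  obtain ⟨CQ, hCQ1, hCQ⟩ := LPIGD.exists_eventually_abs_le hQ
  have hσO : (fun n => (S n).σ) =O[atTop] fun _ => (1 : ℝ) := by
    simpa [LPIGD.Setup.σ, div_eq_mul_inv] using hL₁.1.mul hμ.inv.1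
  obtain ⟨Cσ, hCσ1, hCσ⟩ := LPIGD.exists_eventually_abs_le hσO
  have hκO : (fun n => 110 * (2 * (S n).L₂ + 1) * (S n).c / (S n).b) =O[atTop]
      fun _ => (1 : ℝ) := by
    have h1 := (hL₂.1.const_mul_left 2).add (isBigO_refl (fun _ : ℕ => (1 : ℝ)) atTop)
    have h2 := ((h1.const_mul_left 110).mul hc.1).mul hb.inv.1
    simpa [div_eq_mul_inv] using h2
  obtain ⟨κ, hκ1, hκ⟩ := LPIGD.exists_eventually_abs_le hκO
  obtain ⟨C', hC'⟩ := LPIGD.exists_mul_pow_le_pow_add (2 * κ + 4 + 6 * γ * (γ + 1)) ha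
  have hLtop : Tendsto (fun n : ℕ => Real.log n) atTop atTop :=
    Real.tendsto_log_atTop.comp tendsto_natCast_atTop_atTop
  set r₀ := σ₀ / (σ₀ - 1) with hr₀
  have hr₀1 : 1 ≤ r₀ := (one_le_div (by linarith)).2 (by linarith)
  set D := (r₀ * CQ) ^ (1 / 2 : ℝ) with hD
  have hD1 : 1 ≤ D := Real.one_le_rpow (one_le_mul_of_one_le_of_one_le hr₀1 hCQ1) (by norm_num)
  set CT := Cσ * (Real.log CQ + (α + β)) + 1 with hCT
  -- the number of oracle calls
  have hcalls : ∀ᶠ n in atTop, (S n).Gam (ε n) ≠ ⊤ ∧ (((S n).Gam (ε n)).toNat : ℝ)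
      ≤ CT * (Real.exp C' * D)
        * (Real.log n * Real.exp (2 * √(Real.log n)) * (n : ℝ) ^ (1 / τ)) := by
    filter_upwards [hS, hε_pos, hd19, hd, hη_ge, hl, hσ, hCQ, hCσ, hκ, eventually_ge_atTop 1,
      hLtop.eventually_ge_atTop 1] with n hS hε hd19 hd hη_ge hl hσ hCQ hCσ hκ hn hlog
    have hn1 : (1 : ℝ) ≤ n := by exact_mod_cast hn
    have hn0 : (0 : ℝ) < n := by linarith
    have hσ1 : 1 < (S n).σ := hσ₀.trans_le hσ
    have hμ0 := hS.μ_pos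
    have hη0 := hS.η_pos
    have hGam := LPIGD.Setup.Gam_le hS hn hd19 hl.1 hσ1 hε
    -- Finiteness is needed for the bound to have content, since `toNat` sends `⊤` to `0`.
    refine ⟨ne_top_of_le_ne_top (ENat.natCast_ne_top _) hGam, ?_⟩
    have hGam' : (((S n).Gam (ε n)).toNat : ℝ) ≤ (S n).T (ε n) * ((S n).m (ε n) : ℝ) ^ d n := by
      exact_mod_cast ENat.toNat_le_of_le_natCast hGam
    have hpow1 : (1 : ℝ) ≤ (n : ℝ) ^ (α + β) := Real.one_le_rpow hn1 (by linarith)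
    rw [abs_of_pos (by linarith : (0 : ℝ) < (n : ℝ) ^ (α + β))] at hCQ
    rw [abs_one, mul_one] at hCσ hκ
    have hR1 : 1 ≤ CQ * (n : ℝ) ^ (α + β) := one_le_mul_of_one_le_of_one_le hCQ1 hpow1
    have hQ0 : 0 ≤ ((S n).F (S n).θ₀ - (S n).Fstar + p n / (2 * (S n).μ)) / ε n :=
      div_nonneg (add_nonneg (sub_nonneg.2 (LPIGD.Setup.Fstar_le hS hn hd19 hl.1 _))
        (by positivity)) hε.le
    have hQR := (le_abs_self _).trans hCQ
    have hT : ((S n).T (ε n) : ℝ) ≤ CT * Real.log n := by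
      have h1 := LPIGD.Setup.T_le_log hσ1 hR1 hQ0 hQR
      rw [Real.log_mul (by linarith) (by linarith), Real.log_rpow hn0] at h1
      have hlC : 0 ≤ Real.log CQ := Real.log_nonneg hCQ1
      have h2 : (Real.log ((S n).σ / ((S n).σ - 1)))⁻¹ ≤ Cσ :=
        (LPIGD.Setup.inv_log_le hσ1).trans ((le_abs_self _).trans hCσ)
      calc ((S n).T (ε n) : ℝ)
          ≤ Cσ * (Real.log CQ * Real.log n + (α + β) * Real.log n) + Real.log n := by
            refine h1.trans (add_le_add (mul_le_mul h2 ?_ ?_ (by linarith)) hlog)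
            · gcongr
              exact le_mul_of_one_le_right hlC hlog
            · have : 0 ≤ (α + β) * Real.log n := mul_nonneg (by linarith) (by linarith)
              linarith
        _ = CT * Real.log n := by rw [hCT]; ring
    have hδ : 1 / (S n).δ (ε n) ≤ D * (n : ℝ) ^ ((α + β) / 2) := by
      refine (LPIGD.Setup.inv_δ_le hσ1 hR1 hQ0 hQR).trans ?_
      have hr : (S n).σ / ((S n).σ - 1) ≤ r₀ := by
        rw [hr₀, div_le_div_iff₀ (by linarith) (by linarith)]
        linarith
      calc _ ≤ (r₀ * (CQ * (n : ℝ) ^ (α + β))) ^ (1 / 2 : ℝ) := by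
            have : 0 ≤ (S n).σ / ((S n).σ - 1) := div_nonneg (by linarith) (by linarith)
            gcongr
        _ = D * (n : ℝ) ^ ((α + β) / 2) := by
            rw [← mul_assoc, Real.mul_rpow (by positivity) (by positivity), hD,
              ← Real.rpow_mul hn0.le]
            congr 2
            ring
    have hdη : (d n : ℝ) / (S n).η ≤ 1 := by
      have h1 := (S n).l_le_η (by omega) hη0
      have h2 : (d n : ℝ) ≤ (S n).l := by exact_mod_cast hl.1
      exact (div_le_one hη0).2 (h2.trans h1)
    have hdη0 : 0 ≤ (d n : ℝ) / (S n).η := by positivity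
    have hδ0 := (S n).δ_pos hσ1 (ε n)
    have hδd : (1 / (S n).δ (ε n)) ^ ((d n : ℝ) / (S n).η) ≤ D * (n : ℝ) ^ (1 / τ) := by
      -- `D ≥ 1` and `d/η ≤ 1` bound the constant by `D`; the lower bound on `η` makes the exponent
      -- of `n` at most `1/τ`.
      calc _ ≤ (D * (n : ℝ) ^ ((α + β) / 2)) ^ ((d n : ℝ) / (S n).η) := by gcongr
        _ = D ^ ((d n : ℝ) / (S n).η) * (n : ℝ) ^ ((α + β) / 2 * ((d n : ℝ) / (S n).η)) := by
            rw [Real.mul_rpow (by linarith) (by positivity), ← Real.rpow_mul hn0.le]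
        _ ≤ D ^ (1 : ℝ) * (n : ℝ) ^ (1 / τ) := by
            gcongr
            rw [← mul_div_assoc, div_le_div_iff₀ hη0 (by linarith)]
            linarith
        _ = _ := by rw [Real.rpow_one]
    have hm : ((S n).m (ε n) : ℝ) ^ d n
        ≤ Real.exp (2 * √(Real.log n)) * Real.exp C' * (D * (n : ℝ) ^ (1 / τ)) := by
      refine (LPIGD.Setup.m_pow_le hS hd19 hl.1 hσ1 ((le_abs_self _).trans hκ)).trans ?_
      gcongr
      refine (LPIGD.dimension_factor_le hd19 hl.1 hγ1 hl.2 (by linarith)).trans ?_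
      rw [← Real.exp_add, Real.exp_le_exp]
      have h1 := hC' (d n)
      have h2 := LPIGD.pow_le_sqrt_log ha (by linarith) hd
      -- The estimates yield a single `√(log n)`; the second one in the claimed rate is slack.
      have h3 := Real.sqrt_nonneg (Real.log n)
      linarith
    calc _ ≤ (S n).T (ε n) * ((S n).m (ε n) : ℝ) ^ d n := hGam'
      _ ≤ CT * Real.log n
          * (Real.exp (2 * √(Real.log n)) * Real.exp C' * (D * (n : ℝ) ^ (1 / τ))) := by
          have : 0 ≤ CT * Real.log n := (Nat.cast_nonneg _).trans hT
          gcongr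
      _ = _ := by ring
  have hbigO : (fun n => (((S n).Gam (ε n)).toNat : ℝ)) =O[atTop]
      fun n => Real.log n * Real.exp (2 * √(Real.log n)) * (n : ℝ) ^ (1 / τ) := by
    refine IsBigO.of_bound (CT * (Real.exp C' * D)) ?_
    filter_upwards [hcalls, eventually_ge_atTop 1] with n hn hn1
    have hlog : 0 ≤ Real.log n := Real.log_nonneg (by exact_mod_cast hn1)
    rw [Real.norm_of_nonneg (Nat.cast_nonneg _), Real.norm_of_nonneg (by positivity)]
    exact hn.2
  refine ⟨hcalls.mono fun n hn => hn.1, hbigO, fun G hG => ?_, fun G hG => ?_⟩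
  · have h1 : (fun n : ℕ => (n : ℝ) ^ (1 : ℝ)) =O[atTop]
        fun n => (n : ℝ) * Real.log (1 / ε n) := by
      refine IsBigO.of_bound 1 ?_
      have h0 : Tendsto ε atTop (𝓝 0) :=
        hε.1.trans_tendsto ((tendsto_rpow_neg_atTop hα).comp tendsto_natCast_atTop_atTop)
      filter_upwards [hε_pos, h0.eventually_le_const (Real.exp_pos (-1))] with n hpos hle
      have hlog : 1 ≤ Real.log (1 / ε n) := by
        rw [Real.le_log_iff_exp_le (by positivity), le_div_iff₀ hpos]
        calc Real.exp 1 * ε n ≤ Real.exp 1 * Real.exp (-1) := by gcongr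
          _ = 1 := by rw [← Real.exp_add]; norm_num
      rw [Real.rpow_one, one_mul, norm_mul]
      refine le_mul_of_one_le_right (norm_nonneg _) ?_
      rwa [Real.norm_of_nonneg (by linarith)]
    exact (((hbigO.trans_isLittleO (LPIGD.isLittleO_log_mul_exp_sqrt_mul_rpow
      ((div_lt_one (by linarith)).2 hτ1))).trans_isBigO h1).trans_isBigO hG.2).tendsto_div_nhds_zero
  · have h1 : (fun n : ℕ => (n : ℝ) ^ α) =O[atTop] fun n => 1 / ε n := by
      simpa only [one_div] using hninv.2
    exact (((hbigO.trans_isLittleO (LPIGD.isLittleO_log_mul_exp_sqrt_mul_rpow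
      hτα)).trans_isBigO h1).trans_isBigO hG.2).tendsto_div_nhds_zero
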